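/- **Setting.** Let $\mathcal A$ be a finite alphabet with $d\ge 2$ letters. A *combinatorial datum* is a pair $\pi=(\pi_t,\pi_b)$ of bijections $\mathcal A\to\{1,\dots,d\}$. It is *admissible* if $\pi_t^{-1}\{1,\dots,k\}\ne\pi_b^{-1}\{1,\dots,k\}$ for $1\le k\le d-1$, and *cyclic* if $\pi_b\circ\pi_t^{-1}$ is a cycle of length $d$. Let $\alpha_t,\alpha_b$ denote the letters with $\pi_t(\alpha_t)=\pi_b(\alpha_b)=d$. *Rauzy classes and paths.* For admissible $\pi$, the datum $R^t(\pi)$ has the same top row $\pi_t$, and its bottom row is obtained from $\pi_b$ by moving $\alpha_b$ to position $\pi_b(\alpha_t)+1$ and shifting the letters in positions $\pi_b(\alpha_t)+1,\dots,d-1$ one step to the right; $R^b(\pi)$ is defined in the same way with the roles of $t$ and $b$ exchanged. A *Rauzy class* is a minimal non-empty set of admissible data that is invariant under $R^t$ and $R^b$. An *arrow* is a pair $(\pi,\epsilon)$ with $\epsilon\in\{t,b\}$; it goes from $\pi$ to $R^\epsilon(\pi)$. A *Rauzy path* $\gamma:\pi\to\pi'$ of length $r$ is a sequence of $r\ge 0$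 composable arrows leading from $\pi$ to $\pi'$ (for $r=0$, $\pi=\pi'$). *GIETs.* Let $I=[a,b)$. An element $f$ of $\mathcal G(\pi,I)$, a *generalized interval exchange transformation* (GIET) with datum $\pi$, consists of two partitions $\{I^t_\alpha\}_{\alpha\in\mathcal A}$ and $\{I^b_\alpha\}_{\alpha\in\mathcal A}$ of $I$ into non-empty right-open intervals, where $I^t_\alpha$ and $I^b_\alpha$ are in position $\pi_t(\alpha)$ and $\pi_b(\alpha)$ respectively, counting from the left, and a map $f:I\to I$ that restricts to orientation preserving homeomorphisms $f_\alpha:I^t_\alpha\to I^b_\alpha$. Put $u^t_\alpha(f)=\inf I^t_\alpha$ and $u^b_\alpha(f)=\inf I^b_\alpha$. Let $D_\alpha(f)\subset\mathbb R^2$ be the closure of the graph of $f_\alpha$. *Rauzy induction.* A step of the Rauzy induction is defined on $f\in\mathcal G(\pi,I)$ if $u^t_{\alpha_t}(f)\ne u^b_{\alpha_b}(f)$. Its type is $\epsilon(f)=t$ if $u^t_{\alpha_t}(f)<u^b_{\alpha_b}(f)$ and $\epsilon(f)=b$ if $u^t_{\alpha_t}(f)>u^b_{\alpha_b}(f)$.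 It replaces $f$ by its first return map $\mathcal Q(f)$ to $\widetilde I=[\inf I,\max\{u^t_{\alpha_t}(f),u^b_{\alpha_b}(f)\})$, a GIET with datum $R^{\epsilon(f)}(\pi)$. If $\epsilon(f)=t$, the bottom interval of $\alpha_b$ for $\mathcal Q(f)$ is $f(I^b_{\alpha_b})$, and the left endpoints of all other intervals are unchanged; if $\epsilon(f)=b$, the top interval of $\alpha_t$ for $\mathcal Q(f)$ is $f^{-1}(I^t_{\alpha_t})$, and the left endpoints of all other intervals are unchanged. If the first $r$ steps are defined on $f$, then $\gamma(f,r)$ is the Rauzy path of length $r$ whose $(k+1)$-st arrow, $0\le k<r$, is $(\pi^{(k)},\epsilon(\mathcal Q^k(f)))$, where $\pi^{(k)}$ is the datum of $\mathcal Q^k(f)$. *Degenerations.* For a non-empty proper subset $\mathcal A'\subset\mathcal A$, the *reduction* of $\pi$ to $\mathcal A'$ is the combinatorial datum $\pi'$ over $\mathcal A'$ whose two rows list the letters of $\mathcal A'$ in the same order as those of $\pi$. A *degeneration* over $\pi$ on $I=[a,b)$ is a labelled family $(D_\alpha)_{\alpha\in\mathcal A}$ of subsets of $[a,b]^2$ for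 which there are such an $\mathcal A'$ and an $f\in\mathcal G(\pi',I)$ with $D_\alpha=D_\alpha(f)$ for $\alpha\in\mathcal A'$, while for $\alpha\notin\mathcal A'$ the set $D_\alpha$ is a single point of $$\big(\{u^t_\chi(f):\chi\in\mathcal A'\}\cup\{b\}\big)\times\big(\{u^b_\chi(f):\chi\in\mathcal A'\}\cup\{b\}\big)$$ (points with different labels may coincide). Let $\widehat{\mathcal G}(\pi,I)$ be the union of $\mathcal G(\pi,I)$, where $f$ is identified with $(D_\alpha(f))_{\alpha\in\mathcal A}$, and of the set of all degenerations, with the distance $\sum_{\alpha\in\mathcal A}\mathrm{dist}_H(D_\alpha,D'_\alpha)$, where $\mathrm{dist}_H$ is the Hausdorff distance for the Euclidean metric of $\mathbb R^2$. *Full families.* Let $\Delta^{\mathcal A}=\{\tau\in\mathbb R^{\mathcal A}:\tau_\alpha>0 \text{ for all }\alpha,\ \sum_\alpha\tau_\alpha=1\}$. A *full family* over $\pi$ is a family $(f_\tau)_{\tau\in\Delta^{\mathcal A}}$ in $\mathcal G(\pi,[0,1))$ such that (1) $\tau\mapsto f_\tau$ is continuous; (2) $u^b_\alpha(f_\tau)=\sum_{\pi_b(\chi)<\pi_b(\alpha)}\tau_\chi$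 for all $\tau\in\Delta^{\mathcal A}$ and $\alpha\in\mathcal A$; (3) $\tau\mapsto f_\tau$ extends to a continuous map $\overline{\Delta^{\mathcal A}}\to\widehat{\mathcal G}(\pi,[0,1))$. **Theorem.** Let $\pi$ be an admissible combinatorial datum, let $\mathcal R$ be its Rauzy class, and assume that $\mathcal R$ contains a cyclic combinatorial datum $\pi^{(*)}$. Let $(f_\tau)_{\tau\in\Delta^{\mathcal A}}$ be a full family over $\pi$. Then for every finite Rauzy path $\gamma:\pi\to\pi^{(*)}$ of length $r$ there is $\tau\in\Delta^{\mathcal A}$ such that the first $r$ steps of the Rauzy induction are defined on $f_\tau$ and $\gamma(f_\tau,r)=\gamma$. -/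

import Mathlib

open Set Filter Topology

noncomputable section

namespace FullFamilies

/-! ### Combinatorial data and Rauzy classes -/

/-- A combinatorial datum over the alphabet `𝒜`: a pair of bijections onto the set of positions.
Positions are counted from `0` to `d - 1`, where `d` is the number of letters. -/
@[ext]
structure CombDatum (𝒜 : Type*) [Fintype 𝒜] where
  top : 𝒜 ≃ Fin (Fintype.card 𝒜)
  bot : 𝒜 ≃ Fin (Fintype.card 𝒜)

/-- The two types `t` (top) and `b` (bottom) of Rauzy operations. -/
inductive RauzyType where
  | top
  | bot

/-- For a position `k`: positions up to `k` stay, the last position moves to `k + 1`, and the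
positions strictly between `k` and the last one move one step to the right. -/
def shiftFun {d : ℕ} (k j : Fin d) : Fin d :=
  if h : j ≤ k then j
  else if h' : j.val + 1 = d then ⟨k.val + 1, by have := not_le.mp h; omega⟩
  else ⟨j.val + 1, by omega⟩

theorem shiftFun_injective {d : ℕ} (k : Fin d) : Function.Injective (shiftFun k) := by
  intro i j hij
  unfold shiftFun at hij
  split_ifs at hij <;> simp only [Fin.ext_iff, Fin.le_def] at * <;> omega

/-- `shiftFun k` as a permutation of the positions. -/
def shiftPerm {d : ℕ} (k : Fin d) : Equiv.Perm (Fin d) :=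
  Equiv.ofBijective (shiftFun k) (Finite.injective_iff_bijective.mp (shiftFun_injective k))

namespace CombDatum

/-- The set of letters in the first `k` top positions differs from the one in the first `k`
bottom positions, for `k = 1, …, d - 1`. -/
def Admissible {𝒜 : Type*} [Fintype 𝒜] (π : CombDatum 𝒜) : Prop :=
  ∀ k : ℕ, 1 ≤ k → k < Fintype.card 𝒜 →
    {α : 𝒜 | (π.top α).val < k} ≠ {α : 𝒜 | (π.bot α).val < k}

/-- The permutation `σ(π) = π_b ∘ π_t⁻¹` of the positions. -/
def sigma {𝒜 : Type*} [Fintype 𝒜] (π : CombDatum 𝒜) : Equiv.Perm (Fin (Fintype.card 𝒜)) :=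
  π.top.symm.trans π.bot

/-- `σ(π)` is a cycle of maximal order `d`. -/
def Cyclic {𝒜 : Type*} [Fintype 𝒜] (π : CombDatum 𝒜) : Prop :=
  π.sigma.IsCycle ∧ orderOf π.sigma = Fintype.card 𝒜

/-- The letter `α_t` in the last top position. -/
def lastTop {𝒜 : Type*} [Fintype 𝒜] [Nonempty 𝒜] (π : CombDatum 𝒜) : 𝒜 :=
  π.top.symm ⟨Fintype.card 𝒜 - 1, Nat.sub_lt Fintype.card_pos Nat.one_pos⟩

/-- The letter `α_b` in the last bottom position. -/
def lastBot {𝒜 : Type*} [Fintype 𝒜] [Nonempty 𝒜] (π : CombDatum 𝒜) : 𝒜 :=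
  π.bot.symm ⟨Fintype.card 𝒜 - 1, Nat.sub_lt Fintype.card_pos Nat.one_pos⟩

/-- The Rauzy operations `R^t` and `R^b`. -/
def rauzy {𝒜 : Type*} [Fintype 𝒜] [Nonempty 𝒜] (ε : RauzyType) (π : CombDatum 𝒜) :
    CombDatum 𝒜 :=
  match ε with
  | .top => ⟨π.top, π.bot.trans (shiftPerm (π.bot π.lastTop))⟩
  | .bot => ⟨π.top.trans (shiftPerm (π.top π.lastBot)), π.bot⟩

/-- `π'`, a combinatorial datum over the sub-alphabet `s`, is the reduction of `π` to `s`: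
in each row the letters of `s` appear in the same order as in `π`. -/
def IsReduction {𝒜 : Type*} [Fintype 𝒜] (π : CombDatum 𝒜) (s : Finset 𝒜)
    (π' : CombDatum s) : Prop :=
  (∀ α β : s, π'.top α < π'.top β ↔ π.top α < π.top β) ∧
    (∀ α β : s, π'.bot α < π'.bot β ↔ π.bot α < π.bot β)

end CombDatum

/-- `R` is a (non-empty) set of combinatorial data invariant under `R^t` and `R^b`. -/
def RauzyInvariant {𝒜 : Type*} [Fintype 𝒜] [Nonempty 𝒜] (R : Set (CombDatum 𝒜)) : Prop :=
  R.Nonempty ∧ ∀ π ∈ R, ∀ ε, π.rauzy ε ∈ R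

/-- A Rauzy class: a minimal invariant set of admissible combinatorial data. -/
def IsRauzyClass {𝒜 : Type*} [Fintype 𝒜] [Nonempty 𝒜] (R : Set (CombDatum 𝒜)) : Prop :=
  (∀ π ∈ R, π.Admissible) ∧ RauzyInvariant R ∧ ∀ R' ⊆ R, RauzyInvariant R' → R' = R

/-- An arrow of a Rauzy diagram: its starting vertex and its type. -/
@[ext]
structure RauzyArrow (𝒜 : Type*) [Fintype 𝒜] where
  source : CombDatum 𝒜
  type : RauzyType

/-- The end vertex of an arrow. -/
def RauzyArrow.target {𝒜 : Type*} [Fintype 𝒜] [Nonempty 𝒜] (a : RauzyArrow 𝒜) : CombDatum 𝒜 :=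
  a.source.rauzy a.type

/-- `IsRauzyPath π γ π'`: the list of arrows `γ` is a finite Rauzy path from `π` to `π'`. -/
def IsRauzyPath {𝒜 : Type*} [Fintype 𝒜] [Nonempty 𝒜] :
    CombDatum 𝒜 → List (RauzyArrow 𝒜) → CombDatum 𝒜 → Prop
  | π, [], π' => π = π'
  | π, a :: γ, π' => a.source = π ∧ IsRauzyPath a.target γ π'

/-! ### Generalized interval exchange transformations -/

/-- The data of a labelled piecewise map of `[lo, hi)`: a combinatorial datum, the map (its values
outside `[lo, hi)` are irrelevant), and the left endpoints `crit α` of `I^t_α` and `val α`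
of `I^b_α`. The partitions are part of the data, since the map alone need not determine them. -/
structure PreGIET (𝒜 : Type*) [Fintype 𝒜] where
  datum : CombDatum 𝒜
  lo : ℝ
  hi : ℝ
  map : ℝ → ℝ
  crit : 𝒜 → ℝ
  val : 𝒜 → ℝ

/-- The plane with its Euclidean distance. -/
abbrev Plane := EuclideanSpace ℝ (Fin 2)

/-- The first return map of `f` to `J`. -/
def firstReturn (f : ℝ → ℝ) (J : Set ℝ) (x : ℝ) : ℝ :=
  f^[sInf {n : ℕ | 1 ≤ n ∧ f^[n] x ∈ J}] x

namespace PreGIET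

/-- The right-open interval `I^t_α`, from `crit α` to the next critical point (or to `hi`). -/
def topInterval {𝒜 : Type*} [Fintype 𝒜] (f : PreGIET 𝒜) (α : 𝒜) : Set ℝ :=
  {x | f.crit α ≤ x ∧ x < f.hi ∧ ∀ β, f.datum.top α < f.datum.top β → x < f.crit β}

/-- The right-open interval `I^b_α`, from `val α` to the next critical value (or to `hi`). -/
def botInterval {𝒜 : Type*} [Fintype 𝒜] (f : PreGIET 𝒜) (α : 𝒜) : Set ℝ :=
  {x | f.val α ≤ x ∧ x < f.hi ∧ ∀ β, f.datum.bot α < f.datum.bot β → x < f.val β}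

/-- The data define a GIET of `[lo, hi)`: the `I^t_α` and the `I^b_α` partition `[lo, hi)` into
right-open intervals, in the order prescribed by the combinatorial datum, and each `I^t_α` is
mapped onto `I^b_α` by an orientation preserving homeomorphism. -/
structure IsGIET {𝒜 : Type*} [Fintype 𝒜] (f : PreGIET 𝒜) : Prop where
  lo_lt_hi : f.lo < f.hi
  crit_first : ∀ α, (f.datum.top α).val = 0 → f.crit α = f.lo
  crit_lt : ∀ α β, f.datum.top α < f.datum.top β → f.crit α < f.crit β
  crit_lt_hi : ∀ α, f.crit α < f.hi
  val_first : ∀ α, (f.datum.bot α).val = 0 → f.val α = f.lo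
  val_lt : ∀ α β, f.datum.bot α < f.datum.bot β → f.val α < f.val β
  val_lt_hi : ∀ α, f.val α < f.hi
  continuousOn : ∀ α, ContinuousOn f.map (f.topInterval α)
  strictMonoOn : ∀ α, StrictMonoOn f.map (f.topInterval α)
  image_eq : ∀ α, f.map '' f.topInterval α = f.botInterval α

/-- The closure in the plane of the graph of the continuous branch `f_α`. -/
def branchGraph {𝒜 : Type*} [Fintype 𝒜] (f : PreGIET 𝒜) (α : 𝒜) : Set Plane :=
  closure {p | ∃ x ∈ f.topInterval α, p = !₂[x, f.map x]}

/-! ### Rauzy induction -/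

/-- The condition under which one step of the Rauzy induction is defined. -/
def Renormalizable {𝒜 : Type*} [Fintype 𝒜] [Nonempty 𝒜] (f : PreGIET 𝒜) : Prop :=
  f.crit f.datum.lastTop ≠ f.val f.datum.lastBot

open Classical in
/-- The type `ε(f)`. -/
def type {𝒜 : Type*} [Fintype 𝒜] [Nonempty 𝒜] (f : PreGIET 𝒜) : RauzyType :=
  if f.crit f.datum.lastTop < f.val f.datum.lastBot then .top else .bot

/-- The right endpoint of the interval on which one induces. -/
def newHi {𝒜 : Type*} [Fintype 𝒜] [Nonempty 𝒜] (f : PreGIET 𝒜) : ℝ :=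
  max (f.crit f.datum.lastTop) (f.val f.datum.lastBot)

open Classical in
/-- The Rauzy map `𝒬`: the first return map to `[lo, newHi)`, with datum `R^ε(π)`, `ε = ε(f)`.
If `ε = t` the left endpoints of the top intervals do not change, and the only left endpoint of
a bottom interval that changes is that of the loser `α_b`, whose bottom interval becomes
`f (I^b_{α_b})`. If `ε = b` the left endpoints of the bottom intervals do not change, and the
only left endpoint of a top interval that changes is that of the loser `α_t`, whose top interval
becomes `f⁻¹ (I^t_{α_t})`. -/
def rauzyMap {𝒜 : Type*} [Fintype 𝒜] [Nonempty 𝒜] (f : PreGIET 𝒜) : PreGIET 𝒜 where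
  datum := f.datum.rauzy f.type
  lo := f.lo
  hi := f.newHi
  map := firstReturn f.map (Ico f.lo f.newHi)
  crit := match f.type with
    | .top => f.crit
    | .bot => Function.update f.crit f.datum.lastTop
        (Function.invFunOn f.map (Ico f.lo f.hi) (f.crit f.datum.lastTop))
  val := match f.type with
    | .top => Function.update f.val f.datum.lastBot (f.map (f.val f.datum.lastBot))
    | .bot => f.val

/-- The first `r` steps of the Rauzy induction are defined on `f`. -/
def AdmitsSteps {𝒜 : Type*} [Fintype 𝒜] [Nonempty 𝒜] (f : PreGIET 𝒜) (r : ℕ) : Prop :=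
  ∀ k < r, (rauzyMap^[k] f).Renormalizable

/-- The arrow that encodes one step of the Rauzy induction on `f`. -/
def arrow {𝒜 : Type*} [Fintype 𝒜] [Nonempty 𝒜] (f : PreGIET 𝒜) : RauzyArrow 𝒜 :=
  ⟨f.datum, f.type⟩

/-- The Rauzy path `γ(f, r)` of `f` up to time `r` (meaningful if `f.AdmitsSteps r`). -/
def rauzyPath {𝒜 : Type*} [Fintype 𝒜] [Nonempty 𝒜] (f : PreGIET 𝒜) (r : ℕ) :
    List (RauzyArrow 𝒜) :=
  (List.range r).map fun k => (rauzyMap^[k] f).arrow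

end PreGIET

/-! ### Full families -/

/-- The set `𝒢(π, [a, b))` of GIETs of `[a, b)` with combinatorial datum `π`. -/
def GIETSpace {𝒜 : Type*} [Fintype 𝒜] (π : CombDatum 𝒜) (a b : ℝ) : Set (PreGIET 𝒜) :=
  {f | f.IsGIET ∧ f.datum = π ∧ f.lo = a ∧ f.hi = b}

/-- `D` is the family of labelled pieces `D_α` of a degeneration of a GIET in `𝒢(π, [a, b))`: for
a non-empty proper sub-alphabet `s` and a GIET `f` of `[a, b)` over the reduction of `π` to `s`,
the `D_α` with `α ∈ s` are the closed graphs of the branches of `f`, and the other `D_α` are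
single points whose coordinates are endpoints of continuity intervals of `f` and of `f⁻¹`
respectively. -/
def IsDegeneration {𝒜 : Type*} [Fintype 𝒜] (π : CombDatum 𝒜) (a b : ℝ)
    (D : 𝒜 → Set Plane) : Prop :=
  ∃ s : Finset 𝒜, s.Nonempty ∧ s ≠ Finset.univ ∧
    ∃ π' : CombDatum s, π.IsReduction s π' ∧ ∃ f ∈ GIETSpace π' a b,
      (∀ α : s, D α = f.branchGraph α) ∧
      ∀ α ∉ s, ∃ x ∈ range f.crit ∪ {b}, ∃ y ∈ range f.val ∪ {b}, D α = {!₂[x, y]}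

/-- The extended space `𝒢^(π, [a, b))` of GIETs and degenerations, each given by its pieces. -/
def ExtendedGIETSpace {𝒜 : Type*} [Fintype 𝒜] (π : CombDatum 𝒜) (a b : ℝ) :
    Set (𝒜 → Set Plane) :=
  {D | (∃ f ∈ GIETSpace π a b, D = f.branchGraph) ∨ IsDegeneration π a b D}

/-- The distance between two (possibly degenerate) GIETs, in terms of their pieces. -/
def pieceDist {𝒜 : Type*} [Fintype 𝒜] (D D' : 𝒜 → Set Plane) : ℝ :=
  ∑ α, Metric.hausdorffDist (D α) (D' α)

/-- The open simplex `Δ^𝒜`; its closure is `stdSimplex ℝ 𝒜`. -/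
def openSimplex (𝒜 : Type*) [Fintype 𝒜] : Set (𝒜 → ℝ) :=
  {τ | (∀ α, 0 < τ α) ∧ ∑ α, τ α = 1}

/-- `F`, restricted to the open simplex, is a full family over `π`. -/
structure IsFullFamily {𝒜 : Type*} [Fintype 𝒜] (π : CombDatum 𝒜)
    (F : (𝒜 → ℝ) → PreGIET 𝒜) : Prop where
  mem : ∀ τ ∈ openSimplex 𝒜, F τ ∈ GIETSpace π 0 1
  continuous : ∀ τ ∈ openSimplex 𝒜,
    Tendsto (fun τ' => pieceDist (F τ').branchGraph (F τ).branchGraph)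
      (𝓝[openSimplex 𝒜] τ) (𝓝 0)
  val_eq : ∀ τ ∈ openSimplex 𝒜, ∀ α,
    (F τ).val α = ∑ χ with π.bot χ < π.bot α, τ χ
  extends_continuously : ∃ G : (𝒜 → ℝ) → 𝒜 → Set Plane,
    (∀ τ ∈ openSimplex 𝒜, G τ = (F τ).branchGraph) ∧
    (∀ τ ∈ stdSimplex ℝ 𝒜, G τ ∈ ExtendedGIETSpace π 0 1) ∧
    ∀ τ ∈ stdSimplex ℝ 𝒜,
      Tendsto (fun τ' => pieceDist (G τ') (G τ)) (𝓝[stdSimplex ℝ 𝒜] τ) (𝓝 0)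

end FullFamilies

end

/-!
The theorem is proved by pulling back grids, in the spirit of Thurston's algorithm.

Give the letters length `1` at the end of the path and go back along the path, adding at each arrow
the length of the loser to that of the winner. This gives integer lengths `l` at `π` such that the
translation interval exchange with these lengths follows the path and, on the integers
`0, …, N - 1` with `N = ∑ α, l α`, is a bijection whose first return map to `0, …, d - 1` is
`σ(πstar)`. As `πstar` is cyclic, this bijection `θ` is a single cycle, so only trivial sets are
`θ`-invariant (`DiscreteMinimal`, `exists_discrete_model`). A GIET that permutes the intervals of
some grid `0 = x 0 < … < x N = 1` in the same way as `θ`, and whose endpoints are the corresponding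
grid points, follows the path as well, because all comparisons that Rauzy induction makes are
between grid points (`IsModelledOn.rauzyMap`).

So one needs a parameter `τ` and a grid that is mapped to itself by `f_τ` in this way. A grid with
consecutive distances `g` determines `τ` by the condition that its points include the prescribed
critical values of `f_τ` at the right places; the preimages under `f_τ` of its points form another
grid. The pieces of a GIET or of a degeneration are closed and strictly increasing relations
(`IsMonotonePiece`), whence preimages of grids are unique; they depend on `g` through a closed
relation and exist over the open simplex, so by compactness they exist over the closed simplex and
depend continuously on `g`. Brouwer's theorem (`exists_fixedPoint_stdSimplex`) gives a grid that is
its own preimage (`exists_invariant_grid`). For such a grid the `i`-th interval is degenerate if and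
only if the `θ i`-th is, since both are sides of the same part of a strictly increasing relation. As
`θ` is a single cycle and the distances add up to `1`, no interval is degenerate
(`DiscreteMinimal.gap_pos`); so `τ` lies in the open simplex and `f_τ` is a GIET of the desired type.

Brouwer's theorem is derived from Scarf's lemma (`exists_rainbow_dominant`), whose parity argument
needs no triangulation.
-/

noncomputable section

namespace FullFamilies

/-! ### Scarf's lemma -/

section Scarf

variable {I V L : Type*} [LinearOrder L]

/-- For a family `r i` of rankings of `V`: the set `B` is dominant if no element of `V` is ranked
strictly above the `r i`-lowest element of `B` for every `i` simultaneously. -/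
def Dominant (r : I → V → L) (B : Finset V) : Prop :=
  ∀ y, ∃ i, ∀ x ∈ B, r i y ≤ r i x

/-- `x` is the `r i`-lowest element of `B`. -/
def IsLowest (r : I → V → L) (B : Finset V) (i : I) (x : V) : Prop :=
  x ∈ B ∧ ∀ y ∈ B, r i x ≤ r i y

theorem IsLowest.unique {r : I → V → L} (hr : ∀ i, Function.Injective (r i)) {B : Finset V}
    {i : I} {x y : V} (hx : IsLowest r B i x) (hy : IsLowest r B i y) : x = y :=
  hr i (le_antisymm (hx.2 y hy.1) (hy.2 x hx.1))

theorem Dominant.mono {r : I → V → L} {B E : Finset V} (hB : Dominant r B) (h : E ⊆ B) :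
    Dominant r E := fun y => (hB y).imp fun _ hi x hx => hi x (h hx)

theorem Dominant.exists_isLowest {r : I → V → L} {B : Finset V} (hB : Dominant r B) {x : V}
    (hx : x ∈ B) : ∃ i, IsLowest r B i x :=
  (hB x).imp fun _ hi => ⟨hx, hi⟩

/-- A dominant set with as many elements as there are rankings has a different lowest element for
each ranking. -/
theorem Dominant.isLowest_index_unique [Fintype I] {r : I → V → L}
    (hr : ∀ i, Function.Injective (r i)) {B : Finset V} (hB : Dominant r B)
    (hcard : B.card = Fintype.card I) {i j : I} {x : V} (hi : IsLowest r B i x)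
    (hj : IsLowest r B j x) : i = j := by
  choose φ hφ using fun x : B => hB.exists_isLowest x.2
  have hinj : Function.Injective φ := fun x y hxy =>
    Subtype.ext ((hφ x).unique hr (hxy ▸ hφ y))
  have hsurj : Function.Surjective φ :=
    ((Fintype.bijective_iff_injective_and_card φ).2 ⟨hinj, by simpa using hcard⟩).2
  have key : ∀ k, IsLowest r B k x → k = φ ⟨x, hi.1⟩ := by
    intro k hk
    obtain ⟨x', rfl⟩ := hsurj k
    exact congrArg φ (Subtype.ext ((hφ x').unique hr hk))
  rw [key i hi, key j hj]

/-- The elements that are ranked above the lowest elements `m l` of a set for all `l ≠ k`. -/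
def aboveExcept (r : I → V → L) (m : I → V) (k : I) : Set V :=
  {y | ∀ l, l ≠ k → r l (m l) < r l y}

/-- Let `E` be dominant with one element less than there are rankings, such that its elements are
already lowest for the rankings other than `k`. The elements that extend `E` to a dominant set and
are then lowest for `k` are the `r k`-highest elements of `aboveExcept r m k`; so there is at most
one, and there is one as soon as that set is non-empty. -/
theorem dominant_insert_iff [Fintype I] [DecidableEq V] {r : I → V → L}
    (hr : ∀ i, Function.Injective (r i)) {E : Finset V} (hE : Dominant r E)
    (hcard : E.card + 1 = Fintype.card I) {m : I → V} (hm : ∀ i, IsLowest r E i (m i)) {k : I}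
    (hk : ∀ x ∈ E, ∃ l, l ≠ k ∧ m l = x) (x : V) :
    (x ∉ E ∧ Dominant r (insert x E) ∧ r k x < r k (m k)) ↔
      x ∈ aboveExcept r m k ∧ ∀ y ∈ aboveExcept r m k, r k y ≤ r k x := by
  have hlow : ∀ l, x ∉ E → r l x < r l (m l) → IsLowest r (insert x E) l x := by
    intro l _ h
    refine ⟨Finset.mem_insert_self _ _, fun y hy => ?_⟩
    rcases Finset.mem_insert.1 hy with rfl | hy
    · exact le_rfl
    · exact h.le.trans ((hm l).2 y hy)
  constructor
  · rintro ⟨hxE, hdom, hxk⟩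
    have hcard' : (insert x E).card = Fintype.card I := by
      rw [Finset.card_insert_of_notMem hxE, hcard]
    refine ⟨fun l hl => ?_, fun y hy => ?_⟩
    · refine lt_of_le_of_ne (not_lt.1 fun h => hl ?_) fun h => hxE ?_
      · exact hdom.isLowest_index_unique hr hcard' (hlow l hxE h) (hlow k hxE hxk)
      · rw [← hr l h]; exact (hm l).1
    · obtain ⟨i, hi⟩ := hdom y
      by_cases hik : i = k
      · exact hik ▸ hi x (Finset.mem_insert_self _ _)
      · exact absurd (hi (m i) (Finset.mem_insert_of_mem (hm i).1)) (not_le.2 (hy i hik))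
  · rintro ⟨hx, hmax⟩
    have hxE : x ∉ E := by
      intro h
      obtain ⟨l, hl, rfl⟩ := hk x h
      exact lt_irrefl _ (hx l hl)
    have hxk : r k x < r k (m k) := by
      obtain ⟨i, hi⟩ := hE x
      have hik : i = k := by
        by_contra hik
        exact absurd (hi (m i) (hm i).1) (not_le.2 (hx i hik))
      subst hik
      refine lt_of_le_of_ne (hi _ (hm i).1) fun h => hxE ?_
      rw [hr i h]; exact (hm i).1
    refine ⟨hxE, fun y => ?_, hxk⟩
    by_cases hy : y ∈ aboveExcept r m k
    · refine ⟨k, fun z hz => ?_⟩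
      rcases Finset.mem_insert.1 hz with rfl | hz
      · exact hmax y hy
      · exact ((hmax y hy).trans hxk.le).trans ((hm k).2 z hz)
    · simp only [aboveExcept, mem_ofPred_eq, not_forall, not_lt] at hy
      obtain ⟨l, hl, hly⟩ := hy
      refine ⟨l, fun z hz => ?_⟩
      rcases Finset.mem_insert.1 hz with rfl | hz
      · exact hly.trans (hx l hl).le
      · exact hly.trans ((hm l).2 z hz)

/-- In the situation of `dominant_insert_iff`, if `a ≠ b` are the two rankings of `E` with the same
lowest element, then an element that extends `E` to a dominant set becomes lowest for exactly one
of `a` and `b`. -/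
theorem dominant_insert_cases [Fintype I] [DecidableEq V] {r : I → V → L}
    (hr : ∀ i, Function.Injective (r i)) {E : Finset V}
    (hcard : E.card + 1 = Fintype.card I) {m : I → V} (hm : ∀ i, IsLowest r E i (m i)) {a b : I}
    (hab : a ≠ b) (hmab : m a = m b) {x : V} (hxE : x ∉ E) (hdom : Dominant r (insert x E)) :
    (r a x < r a (m a) ∧ ¬ r b x < r b (m b)) ∨ (r b x < r b (m b) ∧ ¬ r a x < r a (m a)) := by
  have hcard' : (insert x E).card = Fintype.card I := by
    rw [Finset.card_insert_of_notMem hxE, hcard]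
  have hlow : ∀ l, r l x < r l (m l) → IsLowest r (insert x E) l x := by
    intro l h
    refine ⟨Finset.mem_insert_self _ _, fun y hy => ?_⟩
    rcases Finset.mem_insert.1 hy with rfl | hy
    · exact le_rfl
    · exact h.le.trans ((hm l).2 y hy)
  have hlow' : ∀ l, ¬ r l x < r l (m l) → IsLowest r (insert x E) l (m l) := by
    intro l h
    refine ⟨Finset.mem_insert_of_mem (hm l).1, fun y hy => ?_⟩
    rcases Finset.mem_insert.1 hy with rfl | hy
    · exact not_lt.1 h
    · exact (hm l).2 y hy
  by_cases ha : r a x < r a (m a) <;> by_cases hb : r b x < r b (m b)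
  · exact absurd (hdom.isLowest_index_unique hr hcard' (hlow a ha) (hlow b hb)) hab
  · exact Or.inl ⟨ha, hb⟩
  · exact Or.inr ⟨hb, ha⟩
  · exact absurd (hdom.isLowest_index_unique hr hcard' (hlow' a ha) (hmab ▸ hlow' b hb)) hab

theorem mem_dominant_supersets_iff [Fintype I] [DecidableEq V] {r : I → V → L} {E B : Finset V}
    (hcard : E.card + 1 = Fintype.card I) :
    (B.card = Fintype.card I ∧ Dominant r B ∧ E ⊆ B) ↔
      ∃ x, x ∉ E ∧ Dominant r (insert x E) ∧ B = insert x E := by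
  constructor
  · rintro ⟨hB, hdom, hEB⟩
    obtain ⟨x, hx, rfl⟩ : ∃ x, x ∉ E ∧ insert x E = B := by
      have h1 : (B \ E).card = 1 := by
        rw [Finset.card_sdiff_of_subset hEB]; omega
      obtain ⟨x, hx⟩ := Finset.card_eq_one.1 h1
      refine ⟨x, fun h => ?_, ?_⟩
      · have : x ∈ B \ E := by rw [hx]; exact Finset.mem_singleton_self x
        exact (Finset.mem_sdiff.1 this).2 h
      · rw [Finset.insert_eq, ← hx, Finset.sdiff_union_of_subset hEB]
    exact ⟨x, hx, hdom, rfl⟩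
  · rintro ⟨x, hx, hdom, rfl⟩
    exact ⟨by rw [Finset.card_insert_of_notMem hx, hcard], hdom, Finset.subset_insert _ _⟩

/-- A set with fewer elements than there are rankings has an element that is lowest for two of
them. -/
theorem exists_lowest_pair [Fintype I] {r : I → V → L} {E : Finset V} (hne : E.Nonempty)
    (hcard : E.card + 1 = Fintype.card I) :
    ∃ (m : I → V) (a b : I), (∀ i, IsLowest r E i (m i)) ∧ a ≠ b ∧ m a = m b := by
  choose m hm using fun i => E.exists_min_image (r i) hne
  obtain ⟨a, -, b, -, hab, h⟩ := Finset.exists_ne_map_eq_of_card_lt_of_maps_to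
    (s := Finset.univ) (t := E) (f := m) (by rw [Finset.card_univ]; omega)
    (fun i _ => (hm i).1)
  exact ⟨m, a, b, hm, hab, h⟩

/-- All elements of a dominant set are lowest for some ranking other than `a`, if the lowest
element for `a` is also the one for `b ≠ a`. -/
theorem Dominant.exists_lowest_ne {r : I → V → L} (hr : ∀ i, Function.Injective (r i))
    {E : Finset V} (hE : Dominant r E) {m : I → V} (hm : ∀ i, IsLowest r E i (m i)) {a b : I}
    (hab : a ≠ b) (hmab : m a = m b) : ∀ x ∈ E, ∃ l, l ≠ a ∧ m l = x := by
  intro x hx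
  obtain ⟨l, hl⟩ := hE.exists_isLowest hx
  have hlx : m l = x := (hm l).unique hr hl
  by_cases h : l = a
  · exact ⟨b, hab.symm, by rw [← hmab, ← h, hlx]⟩
  · exact ⟨l, h, hlx⟩

/-- If not all colours occur in a set `B` with as many elements as there are colours, then the
number of its subsets in which precisely the colours other than `i₀` occur, each of them once, is
even: it is `0` or `2`. -/
theorem even_card_doors [Fintype I] [DecidableEq I] [DecidableEq V] {col : V → I}
    {B : Finset V} (hB : B.card = Fintype.card I) (hcol : ∃ i, ∀ x ∈ B, col x ≠ i) (i₀ : I) :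
    Even (B.powerset.filter fun E =>
      E.card + 1 = Fintype.card I ∧ E.image col = Finset.univ.erase i₀).card := by
  rcases Finset.eq_empty_or_nonempty (B.powerset.filter fun E =>
      E.card + 1 = Fintype.card I ∧ E.image col = Finset.univ.erase i₀) with h | ⟨E, hE⟩
  · rw [h]; exact ⟨0, rfl⟩
  · simp only [Finset.mem_filter, Finset.mem_powerset] at hE
    obtain ⟨hEB, hcard, him⟩ := hE
    have hinj : Set.InjOn col E := by
      rw [← Finset.card_image_iff, him, Finset.card_erase_of_mem (Finset.mem_univ _),
        Finset.card_univ]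
      omega
    have h1 : (B \ E).card = 1 := by
      rw [Finset.card_sdiff_of_subset hEB]; omega
    obtain ⟨x, hx⟩ := Finset.card_eq_one.1 h1
    have hxB : x ∈ B \ E := by rw [hx]; exact Finset.mem_singleton_self x
    rw [Finset.mem_sdiff] at hxB
    have hBE : B = insert x E := by
      rw [Finset.insert_eq, ← hx, Finset.sdiff_union_of_subset hEB]
    obtain ⟨j, hj⟩ := hcol
    have hxi₀ : col x ≠ i₀ := by
      intro h
      by_cases hji : j = i₀
      · exact hj x hxB.1 (h.trans hji.symm)
      · have : j ∈ E.image col := by rw [him]; exact Finset.mem_erase.2 ⟨hji, Finset.mem_univ _⟩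
        obtain ⟨y, hy, hyj⟩ := Finset.mem_image.1 this
        exact hj y (hEB hy) hyj
    obtain ⟨x', hx', hxx'⟩ : ∃ x' ∈ E, col x' = col x := by
      have : col x ∈ E.image col := by
        rw [him]; exact Finset.mem_erase.2 ⟨hxi₀, Finset.mem_univ _⟩
      simpa using this
    have hne : x ≠ x' := fun h => hxB.2 (h ▸ hx')
    have key : (B.powerset.filter fun E =>
        E.card + 1 = Fintype.card I ∧ E.image col = Finset.univ.erase i₀) =
        {B.erase x, B.erase x'} := by
      ext E'
      simp only [Finset.mem_filter, Finset.mem_powerset, Finset.mem_insert, Finset.mem_singleton]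
      constructor
      · rintro ⟨hE'B, hcard', him'⟩
        have hinj' : Set.InjOn col E' := by
          rw [← Finset.card_image_iff, him', Finset.card_erase_of_mem (Finset.mem_univ _),
            Finset.card_univ]
          omega
        have hE'e : ∀ y ∈ B, y ∉ E' → E' = B.erase y := by
          intro y hy hyE'
          refine Finset.eq_of_subset_of_card_le (fun z hz => Finset.mem_erase.2
            ⟨fun h => hyE' (h ▸ hz), hE'B hz⟩) ?_
          rw [Finset.card_erase_of_mem hy]; omega
        by_cases hxE' : x ∈ E'
        · refine Or.inr (hE'e x' (hEB hx') fun h => hne (hinj' hxE' h hxx'.symm))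
        · exact Or.inl (hE'e x hxB.1 hxE')
      · have hBx : B.erase x = E := by rw [hBE, Finset.erase_insert hxB.2]
        rintro (rfl | rfl)
        · exact ⟨Finset.erase_subset _ _, by rw [hBx]; exact hcard, by rw [hBx]; exact him⟩
        · refine ⟨Finset.erase_subset _ _, ?_, ?_⟩
          · rw [Finset.card_erase_of_mem (hEB hx')]
            have := Finset.card_pos.2 ⟨x, hxB.1⟩
            omega
          · rw [← him, hBE]
            ext i
            simp only [Finset.mem_image, Finset.mem_erase, Finset.mem_insert]
            constructor
            · rintro ⟨y, ⟨hy, rfl | hyE⟩, rfl⟩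
              · exact ⟨x', hx', hxx'⟩
              · exact ⟨y, hyE, rfl⟩
            · rintro ⟨y, hyE, rfl⟩
              by_cases hyx : y = x'
              · exact ⟨x, ⟨hne, Or.inl rfl⟩, by rw [hyx, hxx']⟩
              · exact ⟨y, ⟨hyx, Or.inr hyE⟩, rfl⟩
    rw [key, Finset.card_pair]
    · exact even_two
    · intro h
      have : x' ∈ B.erase x := Finset.mem_erase.2 ⟨hne.symm, hEB hx'⟩
      rw [h] at this
      exact Finset.notMem_erase _ _ this

/-- **Scarf's lemma.** Let `T` be a finite set with rankings `r i`, extended by slack elements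
`inr i`, where `inr i` is lowest for `r i` and above all of `T` for the other rankings. For any
colouring of `T` by the indices, with `inr i` coloured `i`, there is a dominant set with as many
elements as there are indices in which all colours occur. -/
theorem exists_rainbow_dominant {T : Type*} [Fintype I] [Nontrivial I] [Fintype T] [Nonempty T]
    (r : I → T ⊕ I → L) (hr : ∀ i, Function.Injective (r i))
    (hlow : ∀ i t, r i (Sum.inr i) < r i (Sum.inl t))
    (hhigh : ∀ i j t, i ≠ j → r i (Sum.inl t) < r i (Sum.inr j)) (c : T → I) :
    ∃ B : Finset (T ⊕ I), B.card = Fintype.card I ∧ Dominant r B ∧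
      ∀ i, ∃ x ∈ B, Sum.elim c id x = i := by
  classical
  by_contra hno
  push Not at hno
  obtain ⟨i₀⟩ := (inferInstance : Nonempty I)
  set col : T ⊕ I → I := Sum.elim c id with hcol
  -- Rooms are the dominant sets of full size, doors those of one element less that lack only `i₀`.
  -- The pairs of a room and a door in it are counted in two ways.
  set rooms : Finset (Finset (T ⊕ I)) :=
    Finset.univ.filter fun B => B.card = Fintype.card I ∧ Dominant r B with hrooms
  set doors : Finset (Finset (T ⊕ I)) := Finset.univ.filter fun E =>
    E.card + 1 = Fintype.card I ∧ Dominant r E ∧ E.image col = Finset.univ.erase i₀ with hdoors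
  have hcount := Finset.sum_card_bipartiteAbove_eq_sum_card_bipartiteBelow
    (s := rooms) (t := doors) (fun B E => E ⊆ B)
  -- each room has an even number of doors, as it is not rainbow
  have hroom : ∀ B ∈ rooms, Even (Finset.bipartiteAbove (fun B E => E ⊆ B) doors B).card := by
    intro B hB
    obtain ⟨hBcard, hBdom⟩ := (Finset.mem_filter.1 hB).2
    have heq : Finset.bipartiteAbove (fun B E => E ⊆ B) doors B =
        B.powerset.filter fun E =>
          E.card + 1 = Fintype.card I ∧ E.image col = Finset.univ.erase i₀ := by
      ext E
      simp only [Finset.mem_bipartiteAbove, hdoors, Finset.mem_filter, Finset.mem_univ, true_and,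
        Finset.mem_powerset]
      exact ⟨fun h => ⟨h.2, h.1.1, h.1.2.2⟩, fun h => ⟨⟨h.2.1, hBdom.mono h.1, h.2.2⟩, h.1⟩⟩
    rw [heq]
    exact even_card_doors hBcard (hno B hBcard hBdom) i₀
  set E₀ : Finset (T ⊕ I) := (Finset.univ.erase i₀).image Sum.inr with hE₀
  have hcardI : 1 < Fintype.card I := Fintype.one_lt_card
  have hE₀card : E₀.card + 1 = Fintype.card I := by
    rw [hE₀, Finset.card_image_of_injective _ Sum.inr_injective,
      Finset.card_erase_of_mem (Finset.mem_univ _), Finset.card_univ]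
    omega
  obtain ⟨t₀⟩ := (inferInstance : Nonempty T)
  have hslack : ∀ j x, r j (Sum.inr j) ≤ r j x := by
    rintro j (t | i)
    · exact (hlow j t).le
    · by_cases h : j = i
      · rw [h]
      · exact ((hlow j t₀).trans (hhigh j i t₀ h)).le
  have hE₀dom : Dominant r E₀ := by
    rintro (t | j)
    · refine ⟨i₀, fun x hx => ?_⟩
      obtain ⟨j, hj, rfl⟩ := Finset.mem_image.1 hx
      exact (hhigh i₀ j t (Finset.ne_of_mem_erase hj).symm).le
    · exact ⟨j, fun x _ => hslack j x⟩
  have hE₀mem : E₀ ∈ doors := by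
    refine Finset.mem_filter.2 ⟨Finset.mem_univ _, hE₀card, hE₀dom, ?_⟩
    rw [hE₀, Finset.image_image]
    exact Finset.image_id
  have hbelow : ∀ E ∈ doors, ∀ B, B ∈ Finset.bipartiteBelow (fun B E => E ⊆ B) rooms E ↔
      ∃ x, x ∉ E ∧ Dominant r (insert x E) ∧ B = insert x E := by
    intro E hE B
    rw [← mem_dominant_supersets_iff (Finset.mem_filter.1 hE).2.1, Finset.mem_bipartiteBelow,
      hrooms, Finset.mem_filter]
    simp [and_assoc]
  -- the extension of a door at one of its two coincident rankings
  have hext : ∀ E ∈ doors, ∀ m : I → T ⊕ I, (∀ i, IsLowest r E i (m i)) → ∀ a b, a ≠ b →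
      m a = m b → (aboveExcept r m a).Nonempty → ∃ x, x ∉ E ∧ Dominant r (insert x E) ∧
        r a x < r a (m a) ∧ ∀ y, y ∉ E → Dominant r (insert y E) → r a y < r a (m a) → y = x := by
    intro E hE m hm a b hab hmab hne
    obtain ⟨hcard, hdom, -⟩ := (Finset.mem_filter.1 hE).2
    have hiff := dominant_insert_iff hr hdom hcard hm (hdom.exists_lowest_ne hr hm hab hmab)
    obtain ⟨x, hx, hmax⟩ := Set.exists_max_image _ (r a) (Set.toFinite (aboveExcept r m a)) hne
    obtain ⟨h1, h2, h3⟩ := (hiff x).2 ⟨hx, hmax⟩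
    refine ⟨x, h1, h2, h3, fun y hy1 hy2 hy3 => ?_⟩
    obtain ⟨hy, hymax⟩ := (hiff y).1 ⟨hy1, hy2, hy3⟩
    exact hr a (le_antisymm (hmax y hy) (hymax x hx))
  have hdoor₀ : (Finset.bipartiteBelow (fun B E => E ⊆ B) rooms E₀).card = 1 := by
    have hne : E₀.Nonempty := Finset.card_pos.1 (by omega)
    obtain ⟨m, a, b, hm, hab, hmab⟩ := exists_lowest_pair (r := r) hne hE₀card
    have hmi : ∀ l, l ≠ i₀ → m l = Sum.inr l := fun l hl =>
      (hm l).unique hr ⟨Finset.mem_image_of_mem _ (Finset.mem_erase.2 ⟨hl, Finset.mem_univ _⟩),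
        fun y _ => hslack l y⟩
    -- one of the two coincident rankings is `i₀`
    obtain ⟨b, hb, hmb⟩ : ∃ b, i₀ ≠ b ∧ m i₀ = m b := by
      by_cases ha : a = i₀
      · exact ⟨b, ha ▸ hab, ha ▸ hmab⟩
      · by_cases hb : b = i₀
        · exact ⟨a, fun h => ha h.symm, hb ▸ hmab.symm⟩
        · rw [hmi a ha, hmi b hb] at hmab
          exact absurd (Sum.inr_injective hmab) hab
    have hmb' : m i₀ = Sum.inr b := hmb.trans (hmi b hb.symm)
    have hnonempty : (aboveExcept r m i₀).Nonempty :=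
      ⟨Sum.inl t₀, fun l hl => by rw [hmi l hl]; exact hlow l t₀⟩
    have hempty : ∀ y, y ∉ aboveExcept r m b := by
      rintro (t | j) h
      · have := h i₀ hb
        rw [hmb'] at this
        exact lt_asymm this (hhigh i₀ b t hb)
      · by_cases hj : j = i₀
        · have := h i₀ hb
          rw [hj] at this
          exact not_lt.2 (hslack i₀ _) this
        · by_cases hjb : j = b
          · have := h i₀ hb
            rw [hmb', hjb] at this
            exact lt_irrefl _ this
          · have := h j hjb
            rw [hmi j hj] at this
            exact lt_irrefl _ this
    obtain ⟨x, hx1, hx2, hx3, hx4⟩ := hext E₀ hE₀mem m hm i₀ b hb hmb hnonempty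
    rw [Finset.card_eq_one]
    refine ⟨insert x E₀, ?_⟩
    ext B
    rw [hbelow E₀ hE₀mem, Finset.mem_singleton]
    constructor
    · rintro ⟨y, hy1, hy2, rfl⟩
      rcases dominant_insert_cases hr hE₀card hm hb hmb hy1 hy2 with h | h
      · rw [hx4 y hy1 hy2 h.1]
      · have := (dominant_insert_iff hr hE₀dom hE₀card hm
          (hE₀dom.exists_lowest_ne hr hm hb.symm hmb.symm) y).1 ⟨hy1, hy2, h.1⟩
        exact absurd this.1 (hempty y)
    · rintro rfl
      exact ⟨x, hx1, hx2, rfl⟩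
  have hdoor : ∀ E ∈ doors, E ≠ E₀ →
      (Finset.bipartiteBelow (fun B E => E ⊆ B) rooms E).card = 2 := by
    intro E hE hEE₀
    obtain ⟨hcard, hdom, him⟩ := (Finset.mem_filter.1 hE).2
    have hne : E.Nonempty := Finset.card_pos.1 (by omega)
    obtain ⟨m, a, b, hm, hab, hmab⟩ := exists_lowest_pair (r := r) hne hcard
    obtain ⟨t, ht⟩ : ∃ t, Sum.inl t ∈ E := by
      by_contra h
      push Not at h
      refine hEE₀ (Finset.eq_of_subset_of_card_le ?_ (by omega))
      rintro (t | j) hx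
      · exact absurd hx (h t)
      · refine Finset.mem_image_of_mem _ ?_
        rw [← him]
        exact Finset.mem_image.2 ⟨Sum.inr j, hx, rfl⟩
    have hnonempty : ∀ k, (aboveExcept r m k).Nonempty := fun k =>
      ⟨Sum.inr k, fun l hl => ((hm l).2 _ ht).trans_lt (hhigh l k t hl)⟩
    obtain ⟨x, hx1, hx2, hx3, hx4⟩ := hext E hE m hm a b hab hmab (hnonempty a)
    obtain ⟨y, hy1, hy2, hy3, hy4⟩ := hext E hE m hm b a hab.symm hmab.symm (hnonempty b)
    have hxy : insert x E ≠ insert y E := by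
      intro h
      have hx : x ∈ insert y E := h ▸ Finset.mem_insert_self x E
      have hxy : x = y := (Finset.mem_insert.1 hx).resolve_right hx1
      subst hxy
      rcases dominant_insert_cases hr hcard hm hab hmab hx1 hx2 with h | h
      · exact h.2 hy3
      · exact h.2 hx3
    rw [← Finset.card_pair hxy]
    congr 1
    ext B
    rw [hbelow E hE, Finset.mem_insert, Finset.mem_singleton]
    constructor
    · rintro ⟨z, hz1, hz2, rfl⟩
      rcases dominant_insert_cases hr hcard hm hab hmab hz1 hz2 with h | h
      · exact Or.inl (by rw [hx4 z hz1 hz2 h.1])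
      · exact Or.inr (by rw [hy4 z hz1 hz2 h.1])
    · rintro (rfl | rfl)
      · exact ⟨x, hx1, hx2, rfl⟩
      · exact ⟨y, hy1, hy2, rfl⟩
  have hL : Even (∑ B ∈ rooms, (Finset.bipartiteAbove (fun B E => E ⊆ B) doors B).card) :=
    Finset.even_sum _ hroom
  rw [hcount, ← Finset.add_sum_erase _ _ hE₀mem, hdoor₀] at hL
  have hR : Even (∑ E ∈ doors.erase E₀,
      (Finset.bipartiteBelow (fun B E => E ⊆ B) rooms E).card) :=
    Finset.even_sum _ fun E hE => by
      rw [hdoor E (Finset.mem_of_mem_erase hE) (Finset.ne_of_mem_erase hE)]; exact even_two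
  rw [Nat.even_add] at hL
  exact absurd (hL.2 hR) (by decide)

/-- Scarf's lemma for the points with coordinate sum `m` of the integer grid: for every colouring
there is a point such that near it, up to an error independent of `m`, every colour `i` occurs
unless the `i`-th coordinate is small. -/
theorem exists_grid_point [Fintype I] [Nontrivial I] (m : ℕ) (c : (I → ℕ) → I) :
    ∃ p : I → ℕ, ∑ i, p i = m ∧ ∀ i, ∃ q : I → ℕ, ∑ j, q j = m ∧
      (∀ j, p j ≤ q j + Fintype.card I ∧ q j ≤ p j + Fintype.card I) ∧
      (c q = i ∨ q i ≤ Fintype.card I) := by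
  classical
  obtain ⟨i₀⟩ := (inferInstance : Nonempty I)
  let T := {t : I → ℕ // t ∈ Finset.piAntidiag (Finset.univ : Finset I) m}
  have hTmem : ∀ t : I → ℕ, t ∈ Finset.piAntidiag (Finset.univ : Finset I) m ↔ ∑ i, t i = m := by
    intro t; simp [Finset.mem_piAntidiag]
  have hT : ∀ t : T, ∑ i, t.1 i = m := fun t => (hTmem t.1).1 t.2
  have : Nonempty T := ⟨⟨Pi.single i₀ m, by rw [hTmem]; simp⟩⟩
  let e : T ≃ Fin (Fintype.card T) := Fintype.equivFin T
  let e' : I ≃ Fin (Fintype.card I) := Fintype.equivFin I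
  let r : I → T ⊕ I → ℕ ×ₗ ℕ := fun i => Sum.elim (fun t => toLex (t.1 i + 1, (e t).1))
    (fun j => if j = i then toLex (0, 0) else toLex (m + 2, (e' j).1))
  have hle : ∀ (t : T) i, t.1 i ≤ m := fun t i =>
    (Finset.single_le_sum (f := t.1) (fun _ _ => Nat.zero_le _) (Finset.mem_univ i)).trans_eq (hT t)
  have hlow : ∀ i t, r i (Sum.inr i) < r i (Sum.inl t) := by
    intro i t
    simp only [r, Sum.elim_inr, Sum.elim_inl, if_true]
    exact Prod.Lex.toLex_lt_toLex.2 (Or.inl (Nat.succ_pos _))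
  have hhigh : ∀ i j t, i ≠ j → r i (Sum.inl t) < r i (Sum.inr j) := by
    intro i j t hij
    simp only [r, Sum.elim_inr, Sum.elim_inl, if_neg hij.symm]
    exact Prod.Lex.toLex_lt_toLex.2 (Or.inl (by have := hle t i; simp only; omega))
  have hr : ∀ i, Function.Injective (r i) := by
    rintro i (t | j) (t' | j') h
    · simp only [r, Sum.elim_inl, toLex_inj, Prod.mk.injEq] at h
      rw [e.injective (Fin.ext h.2)]
    · by_cases hj : i = j'
      · subst hj; exact absurd h (hlow i t).ne'
      · exact absurd h (hhigh i j' t hj).ne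
    · by_cases hj : i = j
      · subst hj; exact absurd h (hlow i t').ne
      · exact absurd h (hhigh i j t' hj).ne'
    · simp only [r, Sum.elim_inr] at h
      split_ifs at h with h1 h2 h2
      · rw [h1, h2]
      · simp at h
      · simp at h
      · simp only [toLex_inj, Prod.mk.injEq] at h
        rw [e'.injective (Fin.ext h.2)]
  obtain ⟨B, hBcard, hBdom, hBcol⟩ := exists_rainbow_dominant r hr hlow hhigh (fun t => c t.1)
  -- the grid points and the missing slack elements of the dominant set
  set S : Finset T := Finset.univ.filter fun t => Sum.inl t ∈ B with hS
  set C : Finset I := Finset.univ.filter fun i => Sum.inr i ∉ B with hC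
  have hSmem : ∀ t, t ∈ S ↔ Sum.inl t ∈ B := fun t => by simp [hS]
  have hCmem : ∀ i, i ∈ C ↔ Sum.inr i ∉ B := fun i => by simp [hC]
  have hdom : ∀ y : T, ∃ i ∈ C, ∀ t ∈ S, y.1 i ≤ t.1 i := by
    intro y
    obtain ⟨i, hi⟩ := hBdom (Sum.inl y)
    refine ⟨i, (hCmem i).2 fun h => absurd (hi _ h) (not_le.2 (hlow i y)), fun t ht => ?_⟩
    have := hi _ ((hSmem t).1 ht)
    simp only [r, Sum.elim_inl] at this
    have := (Prod.Lex.toLex_le_toLex.1 this)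
    simp only at this
    omega
  obtain ⟨i₁, hi₁, -⟩ := hdom (Classical.arbitrary T)
  have hcolC : ∀ i ∈ C, ∃ t ∈ S, c t.1 = i := by
    intro i hi
    obtain ⟨t | j, hx, hxi⟩ := hBcol i
    · exact ⟨t, (hSmem t).2 hx, hxi⟩
    · simp only [Sum.elim_inr, id] at hxi
      exact absurd (hxi ▸ hx) ((hCmem i).1 hi)
  have hSne : S.Nonempty := (hcolC i₁ hi₁).imp fun _ h => h.1
  choose μ hμS hμ using fun i => S.exists_min_image (fun t => t.1 i) hSne
  have hCcard : C.card ≤ Fintype.card I := Finset.card_le_univ _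
  have hsum : m < ∑ i ∈ C, (μ i).1 i + C.card := by
    by_contra hlt
    push Not at hlt
    let y : I → ℕ := fun i => (if i ∈ C then (μ i).1 i + 1 else 0) +
      if i = i₁ then m - (∑ i ∈ C, (μ i).1 i + C.card) else 0
    have hy : ∑ i, y i = m := by
      simp only [y, Finset.sum_add_distrib, Finset.sum_ite_mem, Finset.univ_inter,
        Finset.sum_ite_eq', Finset.mem_univ, if_true, Finset.sum_const, smul_eq_mul, mul_one]
      omega
    obtain ⟨i, hi, h⟩ := hdom ⟨y, (hTmem y).2 hy⟩
    have := h (μ i) (hμS i)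
    simp only [y, if_pos hi] at this
    omega
  have hnear : ∀ t ∈ S, ∀ i ∈ C, t.1 i ≤ (μ i).1 i + Fintype.card I := by
    intro t ht i hi
    have h1 : ∑ j ∈ C, t.1 j ≤ m :=
      (Finset.sum_le_univ_sum_of_nonneg fun _ => Nat.zero_le _).trans_eq (hT t)
    have h2 : ∑ j ∈ C.erase i, (μ j).1 j ≤ ∑ j ∈ C.erase i, t.1 j :=
      Finset.sum_le_sum fun j _ => hμ j t ht
    have h3 := Finset.add_sum_erase C (fun j => t.1 j) hi
    have h4 := Finset.add_sum_erase C (fun j => (μ j).1 j) hi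
    omega
  have hsmall : ∀ t ∈ S, ∀ i ∉ C, t.1 i ≤ Fintype.card I := by
    intro t ht i hi
    have h1 : t.1 i + ∑ j ∈ C, t.1 j ≤ m := by
      rw [← Finset.sum_insert hi]
      exact (Finset.sum_le_univ_sum_of_nonneg fun _ => Nat.zero_le _).trans_eq (hT t)
    have h2 : ∑ j ∈ C, (μ j).1 j ≤ ∑ j ∈ C, t.1 j := Finset.sum_le_sum fun j _ => hμ j t ht
    omega
  have hclose : ∀ t ∈ S, ∀ t' ∈ S, ∀ j, t.1 j ≤ t'.1 j + Fintype.card I := by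
    intro t ht t' ht' j
    by_cases hj : j ∈ C
    · have h1 := hnear t ht j hj
      have h2 := hμ j t' ht'
      omega
    · have := hsmall t ht j hj
      omega
  obtain ⟨p, hp⟩ := hSne
  refine ⟨p.1, hT p, fun i => ?_⟩
  by_cases hi : i ∈ C
  · obtain ⟨q, hq, hqi⟩ := hcolC i hi
    exact ⟨q.1, hT q, fun j => ⟨hclose p hp q hq j, hclose q hq p hp j⟩, Or.inl hqi⟩
  · exact ⟨p.1, hT p, fun j => ⟨Nat.le_add_right _ _, Nat.le_add_right _ _⟩,
      Or.inr (hsmall p hp i hi)⟩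

end Scarf

/-! ### Brouwer's fixed point theorem on the simplex -/

/-- **Brouwer's fixed point theorem** for the standard simplex. A grid point `q / m` is coloured by
an index `i` with `q i / m ≤ Φ (q / m) i`; Scarf's lemma then gives points at which all
`x i - Φ x i` are almost non-positive. -/
theorem exists_fixedPoint_stdSimplex {I : Type*} [Fintype I] [Nontrivial I]
    {Φ : (I → ℝ) → I → ℝ} (hc : ContinuousOn Φ (stdSimplex ℝ I))
    (hm : MapsTo Φ (stdSimplex ℝ I) (stdSimplex ℝ I)) : ∃ x ∈ stdSimplex ℝ I, Φ x = x := by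
  classical
  obtain ⟨i₀⟩ := (inferInstance : Nonempty I)
  have hK : IsCompact (stdSimplex ℝ I) := isCompact_stdSimplex ℝ I
  have hn : (0 : ℝ) < Fintype.card I := by exact_mod_cast Fintype.card_pos
  set h : (I → ℝ) → ℝ := fun x => ∑ i, max 0 (x i - Φ x i) with hh
  have hcont : ContinuousOn h (stdSimplex ℝ I) := by
    refine continuousOn_finsetSum _ fun i _ => continuousOn_const.sup ?_
    exact (continuous_apply i).continuousOn.sub
      ((continuous_apply i).comp_continuousOn hc)
  obtain ⟨x₀, hx₀, hmin⟩ := hK.exists_isMinOn ⟨_, single_mem_stdSimplex ℝ i₀⟩ hcont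
  have hnn : ∀ x, 0 ≤ h x := fun x => Finset.sum_nonneg fun i _ => le_max_left _ _
  rcases (hnn x₀).eq_or_lt with h0 | hpos
  · refine ⟨x₀, hx₀, ?_⟩
    have h1 : ∀ i, x₀ i ≤ Φ x₀ i := by
      intro i
      have := (Finset.sum_eq_zero_iff_of_nonneg fun i _ => le_max_left _ _).1 h0.symm i
        (Finset.mem_univ i)
      have h2 := le_max_right 0 (x₀ i - Φ x₀ i)
      linarith
    have h2 : ∑ i, x₀ i = ∑ i, Φ x₀ i := by rw [hx₀.2, (hm hx₀).2]
    have h3 := (Finset.sum_eq_sum_iff_of_le fun i _ => h1 i).1 h2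
    exact funext fun i => (h3 i (Finset.mem_univ i)).symm
  · exfalso
    set δ : ℝ := h x₀ / Fintype.card I with hδ
    have hδpos : 0 < δ := div_pos hpos hn
    have hbig : ∀ x ∈ stdSimplex ℝ I, ∃ i, δ ≤ x i - Φ x i := by
      intro x hx
      have h1 : ∑ _i : I, δ ≤ ∑ i, max 0 (x i - Φ x i) := by
        rw [Finset.sum_const, Finset.card_univ, nsmul_eq_mul, hδ, mul_div_cancel₀ _ hn.ne']
        exact hmin hx
      obtain ⟨i, -, hi⟩ := Finset.exists_le_of_sum_le ⟨i₀, Finset.mem_univ _⟩ h1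
      refine ⟨i, ?_⟩
      rcases le_max_iff.1 hi with h2 | h2
      · exact absurd hδpos (not_lt.2 h2)
      · exact h2
    obtain ⟨ε, hε, huc⟩ := Metric.uniformContinuousOn_iff.1
      (hK.uniformContinuousOn_of_continuous hc) (δ / 2) (by linarith)
    obtain ⟨m, hmlarge⟩ := exists_nat_gt (Fintype.card I / min ε (δ / 4))
    have hmin' : 0 < min ε (δ / 4) := lt_min hε (by linarith)
    have hm0 : (0 : ℝ) < m := lt_of_le_of_lt (div_nonneg hn.le hmin'.le) hmlarge
    have hnm : (Fintype.card I : ℝ) / m < min ε (δ / 4) := by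
      rw [div_lt_iff₀ hmin'] at hmlarge
      rw [div_lt_iff₀ hm0, mul_comm]; exact hmlarge
    let s : (I → ℕ) → I → ℝ := fun q i => q i / m
    have hs : ∀ q : I → ℕ, ∑ i, q i = m → s q ∈ stdSimplex ℝ I := by
      intro q hq
      refine ⟨fun i => by positivity, ?_⟩
      simp only [s]
      rw [← Finset.sum_div, ← Nat.cast_sum, hq, div_self hm0.ne']
    have hcol : ∀ q : I → ℕ, ∃ i, ∑ j, q j = m → s q i ≤ Φ (s q) i := by
      intro q
      by_cases hq : ∑ j, q j = m
      · obtain ⟨i, -, hi⟩ := Finset.exists_le_of_sum_le (s := Finset.univ) ⟨i₀, Finset.mem_univ _⟩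
          (le_of_eq ((hs q hq).2.trans (hm (hs q hq)).2.symm))
        exact ⟨i, fun _ => hi⟩
      · exact ⟨i₀, fun h => absurd h hq⟩
    choose c hc' using hcol
    obtain ⟨p, hp, hpq⟩ := exists_grid_point m c
    obtain ⟨i, hi⟩ := hbig _ (hs p hp)
    obtain ⟨q, hq, hclose, hqi⟩ := hpq i
    have hdist : ∀ j, |s p j - s q j| ≤ Fintype.card I / m := by
      intro j
      simp only [s]
      rw [← sub_div, abs_div, abs_of_pos hm0]
      refine div_le_div_of_nonneg_right ?_ hm0.le
      have h1 : (p j : ℝ) ≤ q j + Fintype.card I := by exact_mod_cast (hclose j).1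
      have h2 : (q j : ℝ) ≤ p j + Fintype.card I := by exact_mod_cast (hclose j).2
      rw [abs_le]; constructor <;> linarith
    have hd : dist (s p) (s q) < ε := by
      refine lt_of_le_of_lt ((dist_pi_le_iff (by positivity)).2 hdist)
        (hnm.trans_le (min_le_left _ _))
    have hΦ : |Φ (s p) i - Φ (s q) i| < δ / 2 :=
      lt_of_le_of_lt (dist_le_pi_dist (Φ (s p)) (Φ (s q)) i) (huc _ (hs p hp) _ (hs q hq) hd)
    have hq2 : s q i - Φ (s q) i ≤ Fintype.card I / m := by
      rcases hqi with rfl | hle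
      · have := hc' q hq
        have : (0 : ℝ) ≤ Fintype.card I / m := by positivity
        linarith
      · have h1 : s q i ≤ Fintype.card I / m :=
          div_le_div_of_nonneg_right (by exact_mod_cast hle) hm0.le
        have h2 := (hm (hs q hq)).1 i
        linarith
    have h3 := abs_le.1 (hdist i)
    have h4 := abs_lt.1 hΦ
    have h5 := hnm.trans_le (min_le_right _ _)
    linarith [h3.1, h3.2, h4.1, h4.2]

/-! ### Rows of blocks -/

section Rows

variable {𝒜 M : Type*} [Fintype 𝒜] {d : ℕ}

/-- For letters in the order given by `e` and of lengths `l`: the total length of the first `j`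
letters. -/
def cumLength [AddCommMonoid M] (e : 𝒜 ≃ Fin d) (l : 𝒜 → M) (j : ℕ) : M :=
  ∑ χ with (e χ).val < j, l χ

/-- The left endpoint of the block of length `l α` of the letter `α`, if the blocks are placed side
by side in the order given by `e`. -/
def blockStart [AddCommMonoid M] (e : 𝒜 ≃ Fin d) (l : 𝒜 → M) (α : 𝒜) : M :=
  cumLength e l (e α).val

theorem cumLength_zero [AddCommMonoid M] (e : 𝒜 ≃ Fin d) (l : 𝒜 → M) : cumLength e l 0 = 0 := by
  simp [cumLength]

theorem cumLength_succ [AddCommMonoid M] (e : 𝒜 ≃ Fin d) (l : 𝒜 → M) {j : ℕ} (hj : j < d) :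
    cumLength e l (j + 1) = cumLength e l j + l (e.symm ⟨j, hj⟩) := by
  classical
  have h : (Finset.univ.filter fun χ => (e χ).val < j + 1) =
      insert (e.symm ⟨j, hj⟩) (Finset.univ.filter fun χ => (e χ).val < j) := by
    ext χ
    simp only [Finset.mem_filter, Finset.mem_univ, true_and, Finset.mem_insert,
      Equiv.eq_symm_apply, Fin.ext_iff]
    omega
  rw [cumLength, h, Finset.sum_insert (by simp), add_comm, cumLength]

theorem cumLength_card [AddCommMonoid M] (e : 𝒜 ≃ Fin d) (l : 𝒜 → M) :
    cumLength e l d = ∑ χ, l χ := by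
  rw [cumLength, Finset.filter_true_of_mem fun χ _ => (e χ).isLt]

theorem blockStart_add [AddCommMonoid M] (e : 𝒜 ≃ Fin d) (l : 𝒜 → M) (α : 𝒜) :
    blockStart e l α + l α = cumLength e l ((e α).val + 1) := by
  rw [cumLength_succ e l (e α).isLt, blockStart]; simp

theorem cumLength_mono (e : 𝒜 ≃ Fin d) (l : 𝒜 → ℕ) : Monotone (cumLength e l) := by
  intro i j hij
  refine Finset.sum_le_sum_of_subset fun χ => ?_
  simp only [Finset.mem_filter, Finset.mem_univ, true_and]
  omega

theorem blockStart_add_le (e : 𝒜 ≃ Fin d) (l : 𝒜 → ℕ) {α β : 𝒜} (h : e α < e β) :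
    blockStart e l α + l α ≤ blockStart e l β := by
  rw [blockStart_add]; exact cumLength_mono e l (Nat.succ_le_of_lt h)

theorem blockStart_add_le_sum (e : 𝒜 ≃ Fin d) (l : 𝒜 → ℕ) (α : 𝒜) :
    blockStart e l α + l α ≤ ∑ χ, l χ := by
  rw [blockStart_add, ← cumLength_card e]; exact cumLength_mono e l (e α).isLt

theorem blockStart_add_of_last [AddCommMonoid M] (e : 𝒜 ≃ Fin d) (l : 𝒜 → M) {α : 𝒜}
    (h : (e α).val + 1 = d) : blockStart e l α + l α = ∑ χ, l χ := by
  rw [blockStart_add, h, cumLength_card]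

theorem exists_block (e : 𝒜 ≃ Fin d) (l : 𝒜 → ℕ) {i : ℕ} (hi : i < ∑ χ, l χ) :
    ∃ α k, k < l α ∧ i = blockStart e l α + k := by
  have key : ∀ j ≤ d, i < cumLength e l j → ∃ α k, k < l α ∧ i = blockStart e l α + k := by
    intro j
    induction j with
    | zero => intro _ h; rw [cumLength_zero] at h; omega
    | succ j ih =>
      intro hj h
      rw [cumLength_succ e l hj] at h
      by_cases h' : i < cumLength e l j
      · exact ih (by omega) h'
      · refine ⟨e.symm ⟨j, hj⟩, i - cumLength e l j, by omega, ?_⟩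
        simp only [blockStart, Equiv.apply_symm_apply]
        omega
  exact key d le_rfl (by rwa [cumLength_card])

theorem block_unique (e : 𝒜 ≃ Fin d) (l : 𝒜 → ℕ) {α β : 𝒜} {k m : ℕ} (hk : k < l α)
    (hm : m < l β) (h : blockStart e l α + k = blockStart e l β + m) : α = β ∧ k = m := by
  have hαβ : α = β := by
    rcases lt_trichotomy (e α) (e β) with h' | h' | h'
    · have := blockStart_add_le e l h'; omega
    · exact e.injective h'
    · have := blockStart_add_le e l h'; omega
  subst hαβ
  exact ⟨rfl, by omega⟩

/-- The end of a block is the start of the next one, or the end of the row. -/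
theorem blockStart_add_cases [AddCommMonoid M] (e : 𝒜 ≃ Fin d) (l : 𝒜 → M) (α : 𝒜) :
    ((e α).val + 1 = d ∧ blockStart e l α + l α = ∑ χ, l χ) ∨
      ∃ β, (e β).val = (e α).val + 1 ∧ blockStart e l α + l α = blockStart e l β := by
  by_cases h : (e α).val + 1 = d
  · exact Or.inl ⟨h, blockStart_add_of_last e l h⟩
  · have h' : (e α).val + 1 < d := by have := (e α).isLt; omega
    refine Or.inr ⟨e.symm ⟨_, h'⟩, by simp, ?_⟩
    rw [blockStart_add, blockStart]; simp

theorem blockStart_eq_sum_ite [AddCommMonoid M] (e : 𝒜 ≃ Fin d) (l : 𝒜 → M) (α : 𝒜) :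
    blockStart e l α = ∑ χ, if e χ < e α then l χ else 0 := by
  rw [blockStart, cumLength, Finset.sum_filter]; rfl

end Rows

/-! ### Inverse Rauzy steps on integer lengths -/

section Inverse

variable {𝒜 : Type*}

open Classical in
/-- The lengths before a Rauzy step with winner `w` and loser `s`, in terms of the lengths `l` after
it. -/
def extendLengths (l : 𝒜 → ℕ) (w s : 𝒜) : 𝒜 → ℕ :=
  Function.update l w (l w + l s)

theorem extendLengths_winner (l : 𝒜 → ℕ) (w s : 𝒜) : extendLengths l w s w = l w + l s := by
  simp [extendLengths]

theorem extendLengths_of_ne (l : 𝒜 → ℕ) (w s : 𝒜) {α : 𝒜} (h : α ≠ w) :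
    extendLengths l w s α = l α := by
  simp [extendLengths, h]

theorem le_extendLengths (l : 𝒜 → ℕ) (w s : 𝒜) (α : 𝒜) : l α ≤ extendLengths l w s α := by
  by_cases h : α = w
  · subst h; rw [extendLengths_winner]; omega
  · rw [extendLengths_of_ne _ _ _ h]

theorem extendLengths_eq (l : 𝒜 → ℕ) (w s : 𝒜) [DecidableEq 𝒜] (α : 𝒜) :
    extendLengths l w s α = l α + if α = w then l s else 0 := by
  by_cases h : α = w
  · subst h; rw [extendLengths_winner, if_pos rfl]
  · rw [extendLengths_of_ne _ _ _ h, if_neg h, add_zero]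

variable [Fintype 𝒜]

theorem sum_extendLengths (l : 𝒜 → ℕ) (w s : 𝒜) :
    ∑ χ, extendLengths l w s χ = ∑ χ, l χ + l s := by
  classical
  simp [extendLengths_eq, Finset.sum_add_distrib]

/-- In the row in which the winner is last, the blocks start at the same places before and after
the step. -/
theorem blockStart_winner_row {d : ℕ} (e : 𝒜 ≃ Fin d) (l : 𝒜 → ℕ) {w : 𝒜} (s : 𝒜)
    (hw : (e w).val + 1 = d) (α : 𝒜) :
    blockStart e (extendLengths l w s) α = blockStart e l α := by
  rw [blockStart_eq_sum_ite, blockStart_eq_sum_ite]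
  refine Finset.sum_congr rfl fun χ _ => ?_
  by_cases h : e χ < e α
  · have : χ ≠ w := by
      rintro rfl
      have := (e α).isLt
      rw [Fin.lt_def] at h
      omega
    rw [if_pos h, if_pos h, extendLengths_of_ne _ _ _ this]
  · rw [if_neg h, if_neg h]

theorem shiftPerm_apply {d : ℕ} (k j : Fin d) : shiftPerm k j = shiftFun k j := rfl

/-- In the row in which the loser `s` is last, the blocks of the other letters start at the same
places before and after the step. -/
theorem blockStart_loser_row {d : ℕ} (e : 𝒜 ≃ Fin d) (l : 𝒜 → ℕ) {w s : 𝒜} (hws : w ≠ s)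
    (hs : (e s).val + 1 = d) {α : 𝒜} (hα : α ≠ s) :
    blockStart (e.trans (shiftPerm (e w))) l α = blockStart e (extendLengths l w s) α := by
  classical
  have hne : ∀ χ, χ ≠ s → (e χ).val + 1 ≠ d := fun χ hχ h =>
    hχ (e.injective (Fin.ext (by omega)))
  have hw := hne w hws
  have hα' := hne α hα
  have h1 : blockStart e (extendLengths l w s) α =
      blockStart e l α + if e w < e α then l s else 0 := by
    simp only [blockStart_eq_sum_ite, extendLengths_eq]
    have h : (if e w < e α then l s else 0) =
        ∑ χ, if χ = w then (if e χ < e α then l s else 0) else 0 := by simp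
    rw [h, ← Finset.sum_add_distrib]
    refine Finset.sum_congr rfl fun χ _ => ?_
    split_ifs <;> simp
  rw [h1, blockStart_eq_sum_ite, blockStart_eq_sum_ite,
    ← Finset.add_sum_erase _ _ (Finset.mem_univ s),
    ← Finset.add_sum_erase Finset.univ (fun χ => if e χ < e α then l χ else 0)
      (Finset.mem_univ s)]
  have h2 : ¬ e s < e α := by
    rw [Fin.lt_def]; have := (e α).isLt; omega
  have h3 : (e.trans (shiftPerm (e w))) s < (e.trans (shiftPerm (e w))) α ↔ e w < e α := by
    simp only [Equiv.trans_apply, shiftPerm_apply, shiftFun, Fin.le_def]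
    split_ifs <;> simp only [Fin.lt_def] <;> omega
  have h4 : ∀ χ ∈ Finset.univ.erase s,
      ((e.trans (shiftPerm (e w))) χ < (e.trans (shiftPerm (e w))) α ↔ e χ < e α) := by
    intro χ hχ
    have := hne χ (Finset.ne_of_mem_erase hχ)
    simp only [Equiv.trans_apply, shiftPerm_apply, shiftFun, Fin.le_def]
    split_ifs <;> simp only [Fin.lt_def] <;> omega
  simp only [h2, h3, if_false, zero_add]
  rw [add_comm]
  congr 1
  exact Finset.sum_congr rfl fun χ hχ => by simp only [h4 χ hχ]

/-- After the step the block of the loser starts where the block of the winner ends, in the row in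
which it is moved. -/
theorem blockStart_loser {d : ℕ} (e : 𝒜 ≃ Fin d) (l : 𝒜 → ℕ) {w s : 𝒜} (hws : w ≠ s)
    (hs : (e s).val + 1 = d) :
    blockStart (e.trans (shiftPerm (e w))) l s =
      blockStart e (extendLengths l w s) w + l w := by
  have hw : (e w).val + 1 ≠ d := fun h => hws (e.injective (Fin.ext (by omega)))
  have hwlt := (e w).isLt
  rw [← blockStart_loser_row e l hws hs hws, blockStart_add]
  have : ((e.trans (shiftPerm (e w))) s).val = ((e.trans (shiftPerm (e w))) w).val + 1 := by
    simp only [Equiv.trans_apply, shiftPerm_apply, shiftFun, Fin.le_def]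
    split_ifs <;> first | omega | simp
  rw [blockStart, this]

/-- Before the step the block of the loser is the part that is cut off. -/
theorem blockStart_extend_loser {d : ℕ} (e : 𝒜 ≃ Fin d) (l : 𝒜 → ℕ) {w s : 𝒜} (hws : w ≠ s)
    (hs : (e s).val + 1 = d) : blockStart e (extendLengths l w s) s = ∑ χ, l χ := by
  have h1 := blockStart_add_of_last e (extendLengths l w s) hs
  rw [sum_extendLengths, extendLengths_of_ne _ _ _ hws.symm] at h1
  omega

end Inverse

/-! ### The discrete interval exchange of a combinatorial datum -/

section Discrete

variable {𝒜 : Type*} [Fintype 𝒜]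

/-- The graph of the interval exchange with datum `π` and integer lengths `l`, acting on the
integers `0, …, ∑ α, l α - 1`. -/
def DiscreteIET (π : CombDatum 𝒜) (l : 𝒜 → ℕ) (i j : ℕ) : Prop :=
  ∃ α k, k < l α ∧ i = blockStart π.top l α + k ∧ j = blockStart π.bot l α + k

theorem DiscreteIET.source_lt {π : CombDatum 𝒜} {l : 𝒜 → ℕ} {i j : ℕ}
    (h : DiscreteIET π l i j) : i < ∑ χ, l χ := by
  obtain ⟨α, k, hk, rfl, rfl⟩ := h
  have := blockStart_add_le_sum π.top l α
  omega

theorem DiscreteIET.target_lt {π : CombDatum 𝒜} {l : 𝒜 → ℕ} {i j : ℕ}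
    (h : DiscreteIET π l i j) : j < ∑ χ, l χ := by
  obtain ⟨α, k, hk, rfl, rfl⟩ := h
  have := blockStart_add_le_sum π.bot l α
  omega

/-- The discrete interval exchange is minimal: only trivial sets are invariant. -/
def DiscreteMinimal (π : CombDatum 𝒜) (l : 𝒜 → ℕ) : Prop :=
  ∀ Z : Set ℕ, (∀ i j, DiscreteIET π l i j → (i ∈ Z ↔ j ∈ Z)) →
    (∀ i < ∑ χ, l χ, i ∈ Z) ∨ ∀ i < ∑ χ, l χ, i ∉ Z

/-- If `π` is cyclic, the interval exchange with datum `π` and all lengths equal permutes the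
intervals cyclically. -/
theorem CombDatum.Cyclic.discreteMinimal {π : CombDatum 𝒜} (hπ : π.Cyclic) :
    DiscreteMinimal π fun _ => 1 := by
  intro Z hZ
  obtain ⟨hcyc, hord⟩ := hπ
  have hstart : ∀ (e : 𝒜 ≃ Fin (Fintype.card 𝒜)) α, blockStart e (fun _ => 1) α = (e α).val := by
    intro e α
    have key : ∀ j ≤ Fintype.card 𝒜, cumLength e (fun _ => 1) j = j := by
      intro j
      induction j with
      | zero => intro _; exact cumLength_zero _ _
      | succ j ih => intro hj; rw [cumLength_succ e _ hj, ih (by omega)]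
    exact key _ (e α).isLt.le
  have hinv : ∀ p : Fin (Fintype.card 𝒜), p.val ∈ Z ↔ (π.sigma p).val ∈ Z := fun p =>
    hZ _ _ ⟨π.top.symm p, 0, Nat.one_pos, by simp [hstart], by simp [hstart, CombDatum.sigma]⟩
  have hpow : ∀ (n : ℕ) (p : Fin (Fintype.card 𝒜)), p.val ∈ Z ↔ ((π.sigma ^ n) p).val ∈ Z := by
    intro n
    induction n with
    | zero => intro p; simp
    | succ n ih => intro p; rw [pow_succ, Equiv.Perm.mul_apply, ← ih, ← hinv]
  have hsupp : π.sigma.support = Finset.univ := by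
    rw [← Finset.card_eq_iff_eq_univ, ← hcyc.orderOf, hord, Fintype.card_fin]
  have hall : ∀ p q : Fin (Fintype.card 𝒜), p.val ∈ Z ↔ q.val ∈ Z := by
    intro p q
    have hp : π.sigma p ≠ p := Equiv.Perm.mem_support.1 (hsupp ▸ Finset.mem_univ p)
    have hq : π.sigma q ≠ q := Equiv.Perm.mem_support.1 (hsupp ▸ Finset.mem_univ q)
    obtain ⟨n, rfl⟩ := hcyc.exists_pow_eq hp hq
    exact hpow n p
  simp only [Finset.sum_const, Finset.card_univ, smul_eq_mul, mul_one]
  by_cases h : ∃ p : Fin (Fintype.card 𝒜), p.val ∈ Z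
  · obtain ⟨p, hp⟩ := h
    exact Or.inl fun i hi => (hall p ⟨i, hi⟩).1 hp
  · exact Or.inr fun i hi hiZ => h ⟨⟨i, hi⟩, hiZ⟩

variable [Nonempty 𝒜]

theorem CombDatum.top_lastTop (π : CombDatum 𝒜) :
    (π.top π.lastTop).val + 1 = Fintype.card 𝒜 := by
  have := Fintype.card_pos (α := 𝒜)
  simp only [CombDatum.lastTop, Equiv.apply_symm_apply]
  omega

theorem CombDatum.bot_lastBot (π : CombDatum 𝒜) :
    (π.bot π.lastBot).val + 1 = Fintype.card 𝒜 := by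
  have := Fintype.card_pos (α := 𝒜)
  simp only [CombDatum.lastBot, Equiv.apply_symm_apply]
  omega

theorem CombDatum.Admissible.lastTop_ne_lastBot [Nontrivial 𝒜] {π : CombDatum 𝒜}
    (hπ : π.Admissible) : π.lastTop ≠ π.lastBot := by
  intro h
  have hcard : 1 < Fintype.card 𝒜 := Fintype.one_lt_card
  refine hπ (Fintype.card 𝒜 - 1) (by omega) (by omega) ?_
  have h1 := π.top_lastTop
  have h2 := π.bot_lastBot
  have key : ∀ (e : 𝒜 ≃ Fin (Fintype.card 𝒜)) (β : 𝒜), (e β).val + 1 = Fintype.card 𝒜 →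
      ∀ α, (e α).val < Fintype.card 𝒜 - 1 ↔ α ≠ β := by
    intro e β hβ α
    have := (e α).isLt
    constructor
    · rintro h rfl; omega
    · intro h
      have : (e α).val ≠ (e β).val := fun h' => h (e.injective (Fin.ext h'))
      omega
  ext α
  rw [mem_ofPred_eq, mem_ofPred_eq, key _ _ h1, key _ _ h2, h]

/-- The winner of a Rauzy step. -/
def CombDatum.winner (π : CombDatum 𝒜) : RauzyType → 𝒜
  | .top => π.lastTop
  | .bot => π.lastBot

/-- The loser of a Rauzy step. -/
def CombDatum.loser (π : CombDatum 𝒜) : RauzyType → 𝒜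
  | .top => π.lastBot
  | .bot => π.lastTop

/-- The discrete interval exchange after a Rauzy step is the first return map of the one before: the
return times are `1`, or `2` with a stopover `m` in the part that is cut off. -/
theorem discreteIET_rauzy {π : CombDatum 𝒜} (hπ : π.lastTop ≠ π.lastBot) (ε : RauzyType)
    {l : 𝒜 → ℕ} {i j : ℕ} (h : DiscreteIET (π.rauzy ε) l i j) :
    DiscreteIET π (extendLengths l (π.winner ε) (π.loser ε)) i j ∨
      ∃ m, ∑ χ, l χ ≤ m ∧ DiscreteIET π (extendLengths l (π.winner ε) (π.loser ε)) i m ∧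
        DiscreteIET π (extendLengths l (π.winner ε) (π.loser ε)) m j := by
  obtain ⟨α, k, hk, rfl, rfl⟩ := h
  cases ε with
  | top =>
    simp only [CombDatum.rauzy, CombDatum.winner, CombDatum.loser]
    by_cases hα : α = π.lastBot
    · subst hα
      have h1 := blockStart_winner_row π.top l π.lastBot π.top_lastTop
      have h2 := blockStart_loser π.bot l hπ π.bot_lastBot
      have h3 := blockStart_extend_loser π.bot l hπ π.bot_lastBot
      have h4 := blockStart_add_of_last π.top l π.top_lastTop
      refine Or.inr ⟨∑ χ, l χ + k, Nat.le_add_right _ _, ⟨π.lastBot, k, ?_, ?_, ?_⟩,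
        π.lastTop, l π.lastTop + k, ?_, ?_, ?_⟩
      · exact hk.trans_le (le_extendLengths _ _ _ _)
      · rw [h1]
      · rw [h3]
      · rw [extendLengths_winner]; omega
      · rw [h1]; omega
      · rw [h2]; omega
    · refine Or.inl ⟨α, k, hk.trans_le (le_extendLengths _ _ _ _), ?_, ?_⟩
      · rw [blockStart_winner_row π.top l π.lastBot π.top_lastTop]
      · rw [blockStart_loser_row π.bot l hπ π.bot_lastBot hα]
  | bot =>
    simp only [CombDatum.rauzy, CombDatum.winner, CombDatum.loser]
    by_cases hα : α = π.lastTop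
    · subst hα
      have h1 := blockStart_winner_row π.bot l π.lastTop π.bot_lastBot
      have h2 := blockStart_loser π.top l hπ.symm π.top_lastTop
      have h3 := blockStart_extend_loser π.top l hπ.symm π.top_lastTop
      have h4 := blockStart_add_of_last π.bot l π.bot_lastBot
      refine Or.inr ⟨∑ χ, l χ + k, Nat.le_add_right _ _,
        ⟨π.lastBot, l π.lastBot + k, ?_, ?_, ?_⟩, π.lastTop, k, ?_, ?_, ?_⟩
      · rw [extendLengths_winner]; omega
      · rw [h2]; omega
      · rw [h1]; omega
      · exact hk.trans_le (le_extendLengths _ _ _ _)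
      · rw [h3]
      · rw [h1]
    · refine Or.inl ⟨α, k, hk.trans_le (le_extendLengths _ _ _ _), ?_, ?_⟩
      · rw [blockStart_loser_row π.top l hπ.symm π.top_lastTop hα]
      · rw [blockStart_winner_row π.bot l π.lastTop π.bot_lastBot]

/-- The part that is cut off in a Rauzy step returns immediately. -/
theorem discreteIET_of_ge {π : CombDatum 𝒜} (hπ : π.lastTop ≠ π.lastBot) (ε : RauzyType)
    {l : 𝒜 → ℕ} {i : ℕ} (hi : ∑ χ, l χ ≤ i)
    (hi' : i < ∑ χ, extendLengths l (π.winner ε) (π.loser ε) χ) :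
    ∃ j < ∑ χ, l χ, DiscreteIET π (extendLengths l (π.winner ε) (π.loser ε)) i j := by
  rw [sum_extendLengths] at hi'
  cases ε with
  | top =>
    simp only [CombDatum.winner, CombDatum.loser] at hi' ⊢
    have h1 := blockStart_winner_row π.top l π.lastBot π.top_lastTop
    have h3 := blockStart_extend_loser π.bot l hπ π.bot_lastBot
    have h4 := blockStart_add_of_last π.top l π.top_lastTop
    have h5 := extendLengths_winner l π.lastTop π.lastBot
    have h6 : π.bot π.lastTop < π.bot π.lastBot := by
      have := (π.bot π.lastTop).isLt
      have h7 := π.bot_lastBot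
      have : (π.bot π.lastTop).val ≠ (π.bot π.lastBot).val :=
        fun h' => hπ (π.bot.injective (Fin.ext h'))
      rw [Fin.lt_def]; omega
    have h8 := blockStart_add_le π.bot (extendLengths l π.lastTop π.lastBot) h6
    refine ⟨_, ?_, π.lastTop, i - blockStart π.top l π.lastTop, ?_, ?_, rfl⟩
    · omega
    · omega
    · rw [h1]; omega
  | bot =>
    simp only [CombDatum.winner, CombDatum.loser] at hi' ⊢
    have h1 := blockStart_winner_row π.bot l π.lastTop π.bot_lastBot
    have h3 := blockStart_extend_loser π.top l hπ.symm π.top_lastTop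
    have h4 := blockStart_add_of_last π.bot l π.bot_lastBot
    have h5 := extendLengths_of_ne l π.lastBot π.lastTop hπ
    have h5' := extendLengths_winner l π.lastBot π.lastTop
    have h6 : π.bot π.lastTop < π.bot π.lastBot := by
      have := (π.bot π.lastTop).isLt
      have h7 := π.bot_lastBot
      have : (π.bot π.lastTop).val ≠ (π.bot π.lastBot).val :=
        fun h' => hπ (π.bot.injective (Fin.ext h'))
      rw [Fin.lt_def]; omega
    have h8 := blockStart_add_le π.bot (extendLengths l π.lastBot π.lastTop) h6
    have h9 := h1 π.lastBot
    refine ⟨_, ?_, π.lastTop, i - ∑ χ, l χ, ?_, ?_, rfl⟩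
    · omega
    · omega
    · rw [h3]; omega

theorem DiscreteMinimal.of_rauzy {π : CombDatum 𝒜} (hπ : π.lastTop ≠ π.lastBot) (ε : RauzyType)
    {l : 𝒜 → ℕ} (h : DiscreteMinimal (π.rauzy ε) l) :
    DiscreteMinimal π (extendLengths l (π.winner ε) (π.loser ε)) := by
  intro Z hZ
  have hcut : ∀ i < ∑ χ, extendLengths l (π.winner ε) (π.loser ε) χ,
      ∃ j < ∑ χ, l χ, (i ∈ Z ↔ j ∈ Z) := by
    intro i hi
    by_cases hi' : i < ∑ χ, l χ
    · exact ⟨i, hi', Iff.rfl⟩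
    · obtain ⟨j, hj, hij⟩ := discreteIET_of_ge hπ ε (not_lt.1 hi') hi
      exact ⟨j, hj, hZ i j hij⟩
  have hZ' : ∀ i j, DiscreteIET (π.rauzy ε) l i j → (i ∈ Z ↔ j ∈ Z) := by
    intro i j hij
    rcases discreteIET_rauzy hπ ε hij with h | ⟨m, -, h1, h2⟩
    · exact hZ i j h
    · exact (hZ i m h1).trans (hZ m j h2)
  rcases h Z hZ' with h | h
  · left
    intro i hi
    obtain ⟨j, hj, hij⟩ := hcut i hi
    exact hij.2 (h j hj)
  · right
    intro i hi hiZ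
    obtain ⟨j, hj, hij⟩ := hcut i hi
    exact h j hj (hij.1 hiZ)

end Discrete

/-! ### Rauzy induction along a grid -/

section Grid

/-- The map `f` sends the grid interval `[x i, x (i + 1))` bijectively onto `[x j, x (j + 1))`, and
its left endpoint to the left endpoint. -/
def Transports (f : ℝ → ℝ) (x : ℕ → ℝ) (i j : ℕ) : Prop :=
  f (x i) = x j ∧ BijOn f (Ico (x i) (x (i + 1))) (Ico (x j) (x (j + 1)))

theorem firstReturn_of_mem {f : ℝ → ℝ} {J : Set ℝ} {y : ℝ} (h : f y ∈ J) :
    firstReturn f J y = f y := by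
  have : sInf {n : ℕ | 1 ≤ n ∧ f^[n] y ∈ J} = 1 := by
    refine le_antisymm (Nat.sInf_le ⟨le_rfl, by simpa using h⟩) ?_
    exact (Nat.sInf_mem (s := {n : ℕ | 1 ≤ n ∧ f^[n] y ∈ J}) ⟨1, le_rfl, by simpa using h⟩).1
  rw [firstReturn, this, Function.iterate_one]

theorem firstReturn_of_notMem {f : ℝ → ℝ} {J : Set ℝ} {y : ℝ} (h : f y ∉ J) (h' : f (f y) ∈ J) :
    firstReturn f J y = f (f y) := by
  have : sInf {n : ℕ | 1 ≤ n ∧ f^[n] y ∈ J} = 2 := by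
    refine le_antisymm (Nat.sInf_le ⟨by omega, by simpa using h'⟩) ?_
    have hmem := Nat.sInf_mem (s := {n : ℕ | 1 ≤ n ∧ f^[n] y ∈ J})
      ⟨2, by omega, by simpa using h'⟩
    obtain ⟨h1, h2⟩ := hmem
    by_contra hlt
    have h3 : sInf {n : ℕ | 1 ≤ n ∧ f^[n] y ∈ J} = 1 := by omega
    rw [h3] at h2
    exact h (by simpa using h2)
  rw [firstReturn, this]; rfl

theorem grid_Ico_subset {x : ℕ → ℝ} {N n i : ℕ} (hx : StrictMonoOn x (Iic N)) (hn : n ≤ N)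
    (hi : i < n) : Ico (x i) (x (i + 1)) ⊆ Ico (x 0) (x n) := by
  refine Ico_subset_Ico (hx.monotoneOn ?_ ?_ ?_) (hx.monotoneOn ?_ ?_ ?_) <;>
    first | omega | (simp only [mem_Iic]; omega)

theorem grid_notMem_Ico {x : ℕ → ℝ} {N n i : ℕ} (hx : StrictMonoOn x (Iic N)) (hn : n ≤ i)
    (hi : i < N) {y : ℝ} (hy : y ∈ Ico (x i) (x (i + 1))) : y ∉ Ico (x 0) (x n) := by
  have : x n ≤ x i := hx.monotoneOn (by simp only [mem_Iic]; omega) (by simp only [mem_Iic]; omega)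
    hn
  exact fun h => absurd h.2 (not_lt.2 (this.trans hy.1))

theorem grid_left_mem {x : ℕ → ℝ} {N i : ℕ} (hx : StrictMonoOn x (Iic N)) (hi : i < N) :
    x i ∈ Ico (x i) (x (i + 1)) :=
  ⟨le_rfl, hx (by simp only [mem_Iic]; omega) (by simp only [mem_Iic]; omega) (Nat.lt_succ_self i)⟩

/-- Two grid intervals with a common point are equal. -/
theorem grid_index_unique {x : ℕ → ℝ} {N i j : ℕ} (hx : StrictMonoOn x (Iic N)) (hi : i < N)
    (hj : j < N) {y : ℝ} (hyi : y ∈ Ico (x i) (x (i + 1))) (hyj : y ∈ Ico (x j) (x (j + 1))) :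
    i = j := by
  have key : ∀ {i j}, i < N → j < N → y ∈ Ico (x i) (x (i + 1)) → y ∈ Ico (x j) (x (j + 1)) →
      j ≤ i := by
    intro i j hi hj hyi hyj
    have h := hyj.1.trans_lt hyi.2
    have := (hx.lt_iff_lt (by simp only [mem_Iic]; omega) (by simp only [mem_Iic]; omega)).1 h
    omega
  exact le_antisymm (key hj hi hyj hyi) (key hi hj hyi hyj)

theorem exists_grid_index {x : ℕ → ℝ} {y : ℝ} (n : ℕ) (hy : y ∈ Ico (x 0) (x n)) :
    ∃ i < n, y ∈ Ico (x i) (x (i + 1)) := by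
  induction n with
  | zero => exact absurd hy.2 (not_lt.2 hy.1)
  | succ n ih =>
    by_cases h : y < x n
    · obtain ⟨i, hi, h'⟩ := ih ⟨hy.1, h⟩
      exact ⟨i, by omega, h'⟩
    · exact ⟨n, by omega, not_lt.1 h, hy.2⟩

theorem Transports.firstReturn_one {f : ℝ → ℝ} {x : ℕ → ℝ} {N n i j : ℕ}
    (hx : StrictMonoOn x (Iic N)) (hn : n ≤ N) (h : Transports f x i j) (hi : i < N) (hj : j < n) :
    Transports (firstReturn f (Ico (x 0) (x n))) x i j := by
  have key : ∀ y ∈ Ico (x i) (x (i + 1)), firstReturn f (Ico (x 0) (x n)) y = f y := fun y hy =>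
    firstReturn_of_mem (grid_Ico_subset hx hn hj (h.2.mapsTo hy))
  exact ⟨(key _ (grid_left_mem hx hi)).trans h.1, h.2.congr fun y hy => (key y hy).symm⟩

theorem Transports.firstReturn_two {f : ℝ → ℝ} {x : ℕ → ℝ} {N n i m j : ℕ}
    (hx : StrictMonoOn x (Iic N)) (hn : n ≤ N) (h : Transports f x i m) (h' : Transports f x m j)
    (hi : i < N) (hm : n ≤ m) (hmN : m < N) (hj : j < n) :
    Transports (firstReturn f (Ico (x 0) (x n))) x i j := by
  have key : ∀ y ∈ Ico (x i) (x (i + 1)),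
      firstReturn f (Ico (x 0) (x n)) y = f (f y) := fun y hy =>
    firstReturn_of_notMem (grid_notMem_Ico hx hm hmN (h.2.mapsTo hy))
      (grid_Ico_subset hx hn hj (h'.2.mapsTo (h.2.mapsTo hy)))
  refine ⟨?_, (h'.2.comp h.2).congr fun y hy => (key y hy).symm⟩
  rw [key _ (grid_left_mem hx hi), h.1, h'.1]

variable {𝒜 : Type*} [Fintype 𝒜]

/-- The points `x 0 < x 1 < … < x N` contain all endpoints of `f`, and `f` permutes the intervals
between them as the interval exchange with the same datum and with integer lengths `l`, where
`N = ∑ α, l α`. -/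
structure IsModelledOn (f : PreGIET 𝒜) (l : 𝒜 → ℕ) (x : ℕ → ℝ) : Prop where
  strictMonoOn : StrictMonoOn x (Iic (∑ χ, l χ))
  lo_eq : f.lo = x 0
  hi_eq : f.hi = x (∑ χ, l χ)
  crit_eq : ∀ α, f.crit α = x (blockStart f.datum.top l α)
  val_eq : ∀ α, f.val α = x (blockStart f.datum.bot l α)
  transports : ∀ i j, DiscreteIET f.datum l i j → Transports f.map x i j

variable [Nonempty 𝒜]

/-- The first return map to the shortened grid acts on it as the discrete interval exchange after the
Rauzy step. -/
theorem IsModelledOn.firstReturn {f : PreGIET 𝒜} (hπ : f.datum.lastTop ≠ f.datum.lastBot)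
    (ε : RauzyType) {l : 𝒜 → ℕ} {x : ℕ → ℝ}
    (h : IsModelledOn f (extendLengths l (f.datum.winner ε) (f.datum.loser ε)) x) {i j : ℕ}
    (hij : DiscreteIET (f.datum.rauzy ε) l i j) :
    Transports (firstReturn f.map (Ico (x 0) (x (∑ χ, l χ)))) x i j := by
  have hle : ∑ χ, l χ ≤ ∑ χ, extendLengths l (f.datum.winner ε) (f.datum.loser ε) χ := by
    rw [sum_extendLengths]; omega
  have hi := hij.source_lt
  have hj := hij.target_lt
  rcases discreteIET_rauzy hπ ε hij with h1 | ⟨m, hm, h1, h2⟩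
  · exact (h.transports i j h1).firstReturn_one h.strictMonoOn hle (by omega) hj
  · exact (h.transports i m h1).firstReturn_two h.strictMonoOn hle (h.transports m j h2)
      (by omega) hm h2.source_lt hj

theorem IsModelledOn.rauzyMap_top {f : PreGIET 𝒜} (hπ : f.datum.lastTop ≠ f.datum.lastBot)
    {l : 𝒜 → ℕ} (hl : ∀ α, 0 < l α) {x : ℕ → ℝ}
    (h : IsModelledOn f (extendLengths l f.datum.lastTop f.datum.lastBot) x) :
    f.Renormalizable ∧ f.type = .top ∧ IsModelledOn f.rauzyMap l x := by
  have hN := sum_extendLengths l f.datum.lastTop f.datum.lastBot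
  have h1 := blockStart_winner_row f.datum.top l f.datum.lastBot f.datum.top_lastTop
  have h3 := blockStart_extend_loser f.datum.bot l hπ f.datum.bot_lastBot
  have h4 := blockStart_add_of_last f.datum.top l f.datum.top_lastTop
  have hcrit : f.crit f.datum.lastTop = x (blockStart f.datum.top l f.datum.lastTop) := by
    rw [h.crit_eq, h1]
  have hval : f.val f.datum.lastBot = x (∑ χ, l χ) := by rw [h.val_eq, h3]
  have hlt : f.crit f.datum.lastTop < f.val f.datum.lastBot := by
    rw [hcrit, hval]
    have := hl f.datum.lastTop
    exact h.strictMonoOn (by simp only [mem_Iic]; omega) (by simp only [mem_Iic]; omega) (by omega)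
  have htype : f.type = .top := by simp [PreGIET.type, hlt]
  have hhi : f.newHi = x (∑ χ, l χ) := by rw [PreGIET.newHi, max_eq_right hlt.le, hval]
  refine ⟨hlt.ne, htype, ?_, h.lo_eq, hhi, ?_, ?_, ?_⟩
  · exact h.strictMonoOn.mono (Iic_subset_Iic.2 (by omega))
  · classical
    intro α
    simp only [PreGIET.rauzyMap, htype, CombDatum.rauzy]
    rw [h.crit_eq, h1]
  · classical
    intro α
    simp only [PreGIET.rauzyMap, htype, CombDatum.rauzy]
    by_cases hα : α = f.datum.lastBot
    · subst hα
      rw [Function.update_self, blockStart_loser f.datum.bot l hπ f.datum.bot_lastBot, hval]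
      refine (h.transports _ _ ⟨f.datum.lastTop, l f.datum.lastTop, ?_, ?_, rfl⟩).1
      · rw [extendLengths_winner]; have := hl f.datum.lastBot; omega
      · rw [h1]; omega
    · rw [Function.update_of_ne hα, h.val_eq,
        blockStart_loser_row f.datum.bot l hπ f.datum.bot_lastBot hα]
  · intro i j hij
    simp only [PreGIET.rauzyMap, htype, hhi, h.lo_eq] at hij ⊢
    exact IsModelledOn.firstReturn hπ .top h hij

theorem IsModelledOn.rauzyMap_bot {f : PreGIET 𝒜} (hπ : f.datum.lastTop ≠ f.datum.lastBot)
    {l : 𝒜 → ℕ} (hl : ∀ α, 0 < l α) {x : ℕ → ℝ}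
    (h : IsModelledOn f (extendLengths l f.datum.lastBot f.datum.lastTop) x) :
    f.Renormalizable ∧ f.type = .bot ∧ IsModelledOn f.rauzyMap l x := by
  have hN := sum_extendLengths l f.datum.lastBot f.datum.lastTop
  have h1 := blockStart_winner_row f.datum.bot l f.datum.lastTop f.datum.bot_lastBot
  have h3 := blockStart_extend_loser f.datum.top l hπ.symm f.datum.top_lastTop
  have h4 := blockStart_add_of_last f.datum.bot l f.datum.bot_lastBot
  have hval : f.val f.datum.lastBot = x (blockStart f.datum.bot l f.datum.lastBot) := by
    rw [h.val_eq, h1]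
  have hcrit : f.crit f.datum.lastTop = x (∑ χ, l χ) := by rw [h.crit_eq, h3]
  have hlt : f.val f.datum.lastBot < f.crit f.datum.lastTop := by
    rw [hcrit, hval]
    have := hl f.datum.lastBot
    exact h.strictMonoOn (by simp only [mem_Iic]; omega) (by simp only [mem_Iic]; omega) (by omega)
  have htype : f.type = .bot := by simp [PreGIET.type, hlt.not_gt]
  have hhi : f.newHi = x (∑ χ, l χ) := by rw [PreGIET.newHi, max_eq_left hlt.le, hcrit]
  refine ⟨hlt.ne', htype, ?_, h.lo_eq, hhi, ?_, ?_, ?_⟩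
  · exact h.strictMonoOn.mono (Iic_subset_Iic.2 (by omega))
  · classical
    intro α
    simp only [PreGIET.rauzyMap, htype, CombDatum.rauzy]
    by_cases hα : α = f.datum.lastTop
    · subst hα
      rw [Function.update_self, blockStart_loser f.datum.top l hπ.symm f.datum.top_lastTop]
      -- the preimage of the last critical point is unique, as `f` permutes the grid intervals
      have hstep : DiscreteIET f.datum (extendLengths l f.datum.lastBot f.datum.lastTop)
          (blockStart f.datum.top (extendLengths l f.datum.lastBot f.datum.lastTop)
            f.datum.lastBot + l f.datum.lastBot) (∑ χ, l χ) := by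
        refine ⟨f.datum.lastBot, l f.datum.lastBot, ?_, rfl, ?_⟩
        · rw [extendLengths_winner]; have := hl f.datum.lastTop; omega
        · rw [h1]; omega
      have htr := h.transports _ _ hstep
      set p := blockStart f.datum.top (extendLengths l f.datum.lastBot f.datum.lastTop)
            f.datum.lastBot + l f.datum.lastBot
      have hpN := hstep.source_lt
      have hmem : x p ∈ Ico f.lo f.hi := by
        rw [h.lo_eq, h.hi_eq]
        exact grid_Ico_subset h.strictMonoOn le_rfl hpN (grid_left_mem h.strictMonoOn hpN)
      have hex : ∃ z ∈ Ico f.lo f.hi, f.map z = f.crit f.datum.lastTop :=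
        ⟨x p, hmem, htr.1.trans hcrit.symm⟩
      obtain ⟨hz, hfz⟩ := And.intro (Function.invFunOn_mem hex) (Function.invFunOn_eq hex)
      set z := Function.invFunOn f.map (Ico f.lo f.hi) (f.crit f.datum.lastTop)
      rw [h.lo_eq, h.hi_eq] at hz
      obtain ⟨i, hi, hzi⟩ := exists_grid_index _ hz
      obtain ⟨α, k, hk, rfl⟩ := exists_block f.datum.top _ hi
      have hstep' : DiscreteIET f.datum (extendLengths l f.datum.lastBot f.datum.lastTop) _ _ :=
        ⟨α, k, hk, rfl, rfl⟩
      have htr' := h.transports _ _ hstep'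
      have hfz' := htr'.2.mapsTo hzi
      rw [hfz, hcrit] at hfz'
      have hidx := grid_index_unique h.strictMonoOn hstep'.target_lt hstep.target_lt hfz'
        (grid_left_mem h.strictMonoOn hstep.target_lt)
      have hblock := block_unique f.datum.bot _ (β := f.datum.lastBot) (m := l f.datum.lastBot) hk
        (by rw [extendLengths_winner]; have := hl f.datum.lastTop; omega)
        (by rw [hidx, h1]; omega)
      obtain ⟨rfl, rfl⟩ := hblock
      refine htr.2.injOn hzi (grid_left_mem h.strictMonoOn hpN) ?_
      rw [hfz, htr.1, hcrit]
    · rw [Function.update_of_ne hα, h.crit_eq,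
        blockStart_loser_row f.datum.top l hπ.symm f.datum.top_lastTop hα]
  · classical
    intro α
    simp only [PreGIET.rauzyMap, htype, CombDatum.rauzy]
    rw [h.val_eq, h1]
  · intro i j hij
    simp only [PreGIET.rauzyMap, htype, hhi, h.lo_eq] at hij ⊢
    exact IsModelledOn.firstReturn hπ .bot h hij

theorem IsModelledOn.rauzyMap {f : PreGIET 𝒜} (hπ : f.datum.lastTop ≠ f.datum.lastBot)
    (ε : RauzyType) {l : 𝒜 → ℕ} (hl : ∀ α, 0 < l α) {x : ℕ → ℝ}
    (h : IsModelledOn f (extendLengths l (f.datum.winner ε) (f.datum.loser ε)) x) :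
    f.Renormalizable ∧ f.type = ε ∧ IsModelledOn f.rauzyMap l x := by
  cases ε with
  | top => exact IsModelledOn.rauzyMap_top hπ hl h
  | bot => exact IsModelledOn.rauzyMap_bot hπ hl h

theorem PreGIET.admitsSteps_succ {f : PreGIET 𝒜} {r : ℕ} (h : f.Renormalizable)
    (h' : f.rauzyMap.AdmitsSteps r) : f.AdmitsSteps (r + 1) := by
  intro k hk
  cases k with
  | zero => exact h
  | succ k => rw [Function.iterate_succ_apply]; exact h' k (by omega)

theorem PreGIET.rauzyPath_succ (f : PreGIET 𝒜) (r : ℕ) :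
    f.rauzyPath (r + 1) = f.arrow :: f.rauzyMap.rauzyPath r := by
  simp [PreGIET.rauzyPath, List.range_succ_eq_map, Function.comp_def]

/-- Every path in a Rauzy diagram that ends at a cyclic datum has a minimal discrete interval
exchange such that all maps modelled on it follow the path: start with equal lengths at the end of
the path and go back along the path. -/
theorem exists_discrete_model [Nontrivial 𝒜] {πstar : CombDatum 𝒜} (hstar : πstar.Cyclic)
    {R : Set (CombDatum 𝒜)} (hadm : ∀ π ∈ R, π.Admissible) (hinv : ∀ π ∈ R, ∀ ε, π.rauzy ε ∈ R)
    (γ : List (RauzyArrow 𝒜)) : ∀ π ∈ R, IsRauzyPath π γ πstar →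
      ∃ l : 𝒜 → ℕ, (∀ α, 0 < l α) ∧ DiscreteMinimal π l ∧
        ∀ (f : PreGIET 𝒜) (x : ℕ → ℝ), f.datum = π → IsModelledOn f l x →
          f.AdmitsSteps γ.length ∧ f.rauzyPath γ.length = γ := by
  induction γ with
  | nil =>
    rintro π - rfl
    exact ⟨fun _ => 1, fun _ => Nat.one_pos, hstar.discreteMinimal, fun f x _ _ =>
      ⟨fun k hk => absurd hk (Nat.not_lt_zero k), rfl⟩⟩
  | cons a γ ih =>
    rintro π hπR ⟨hsource, hpath⟩
    have hπ := (hadm π hπR).lastTop_ne_lastBot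
    rw [RauzyArrow.target, hsource] at hpath
    obtain ⟨l, hl, hmin, hmodel⟩ := ih _ (hinv π hπR a.type) hpath
    refine ⟨extendLengths l (π.winner a.type) (π.loser a.type),
      fun α => (hl α).trans_le (le_extendLengths _ _ _ _), hmin.of_rauzy hπ, ?_⟩
    rintro f x rfl hf
    obtain ⟨h1, h2, h3⟩ := hf.rauzyMap hπ a.type hl
    obtain ⟨h4, h5⟩ := hmodel f.rauzyMap x (by rw [← h2]; rfl) h3
    refine ⟨PreGIET.admitsSteps_succ h1 h4, ?_⟩
    rw [List.length_cons, PreGIET.rauzyPath_succ, h5]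
    congr 1
    exact RauzyArrow.ext hsource.symm h2

end Grid

/-! ### Branches of generalized interval exchange transformations -/

section Branches

variable {𝒜 : Type*} [Fintype 𝒜]

theorem norm_plane_le (z : Plane) : ‖z‖ ≤ |z 0| + |z 1| := by
  rw [EuclideanSpace.norm_eq, Fin.sum_univ_two]
  refine Real.sqrt_le_iff.2 ⟨by positivity, ?_⟩
  simp only [Real.norm_eq_abs]
  nlinarith [abs_nonneg (z 0), abs_nonneg (z 1)]

theorem abs_apply_le_norm (z : Plane) (i : Fin 2) : |z i| ≤ ‖z‖ :=
  PiLp.norm_apply_le z i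

/-- The intervals of a partition with left endpoints `c`, placed in the order `e`, in terms of a
grid that contains these endpoints. -/
theorem interval_eq_grid_Ico {d : ℕ} (e : 𝒜 ≃ Fin d) (l : 𝒜 → ℕ) {c : 𝒜 → ℝ} {hi : ℝ} {x : ℕ → ℝ}
    (hmono : ∀ α β, e α < e β → c α < c β) (hlt : ∀ α, c α < hi)
    (hc : ∀ α, c α = x (blockStart e l α)) (hhi : hi = x (∑ χ, l χ)) (α : 𝒜) :
    {z | c α ≤ z ∧ z < hi ∧ ∀ β, e α < e β → z < c β} =
      Ico (x (blockStart e l α)) (x (blockStart e l α + l α)) := by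
  rw [← hc]
  rcases blockStart_add_cases e l α with ⟨hα, h⟩ | ⟨β, hβ, h⟩
  · rw [h, ← hhi]
    ext z
    refine ⟨fun hz => ⟨hz.1, hz.2.1⟩, fun hz => ⟨hz.1, hz.2, fun β hβ => ?_⟩⟩
    have := (e β).isLt
    rw [Fin.lt_def] at hβ
    omega
  · rw [h, ← hc]
    ext z
    refine ⟨fun hz => ⟨hz.1, hz.2.2 β (by rw [Fin.lt_def]; omega)⟩,
      fun hz => ⟨hz.1, hz.2.trans (hlt β), fun β' hβ' => ?_⟩⟩
    rcases eq_or_ne β' β with rfl | hne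
    · exact hz.2
    · refine hz.2.trans (hmono β β' ?_)
      have : (e β').val ≠ (e β).val := fun h => hne (e.injective (Fin.ext h))
      rw [Fin.lt_def] at hβ' ⊢
      omega

variable {f : PreGIET 𝒜}

theorem PreGIET.IsGIET.crit_mem (hf : f.IsGIET) (α : 𝒜) : f.crit α ∈ f.topInterval α :=
  ⟨le_rfl, hf.crit_lt_hi α, fun β h => hf.crit_lt α β h⟩

theorem PreGIET.IsGIET.val_mem (hf : f.IsGIET) (α : 𝒜) : f.val α ∈ f.botInterval α :=
  ⟨le_rfl, hf.val_lt_hi α, fun β h => hf.val_lt α β h⟩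

theorem PreGIET.IsGIET.map_mem (hf : f.IsGIET) {α : 𝒜} {s : ℝ} (hs : s ∈ f.topInterval α) :
    f.map s ∈ f.botInterval α :=
  hf.image_eq α ▸ mem_image_of_mem _ hs

theorem PreGIET.IsGIET.exists_preimage (hf : f.IsGIET) {α : 𝒜} {t : ℝ}
    (ht : t ∈ f.botInterval α) : ∃ s ∈ f.topInterval α, f.map s = t := by
  rw [← hf.image_eq α] at ht; exact ht

theorem PreGIET.IsGIET.map_crit (hf : f.IsGIET) (α : 𝒜) : f.map (f.crit α) = f.val α := by
  refine le_antisymm ?_ (hf.map_mem (hf.crit_mem α)).1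
  obtain ⟨s, hs, hfs⟩ := hf.exists_preimage (hf.val_mem α)
  rw [← hfs]
  exact (hf.strictMonoOn α).monotoneOn (hf.crit_mem α) hs hs.1

theorem PreGIET.IsGIET.lo_le_crit (hf : f.IsGIET) (α : 𝒜) : f.lo ≤ f.crit α := by
  have h0 : 0 < Fintype.card 𝒜 := lt_of_le_of_lt (Nat.zero_le _) (f.datum.top α).isLt
  set β := f.datum.top.symm ⟨0, h0⟩ with hβ
  have h1 : (f.datum.top β).val = 0 := by simp [hβ]
  rw [← hf.crit_first β h1]
  rcases eq_or_ne α β with rfl | hne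
  · exact le_rfl
  · refine (hf.crit_lt β α ?_).le
    have : (f.datum.top α).val ≠ (f.datum.top β).val :=
      fun h => hne (f.datum.top.injective (Fin.ext h))
    rw [Fin.lt_def]
    omega

theorem PreGIET.mk_mem_branchGraph {α : 𝒜} {s : ℝ} (hs : s ∈ f.topInterval α) :
    (!₂[s, f.map s] : Plane) ∈ f.branchGraph α :=
  subset_closure ⟨s, hs, rfl⟩

theorem PreGIET.exists_near_of_mem_branchGraph {α : 𝒜} {z : Plane} (hz : z ∈ f.branchGraph α)
    {ε : ℝ} (hε : 0 < ε) :
    ∃ s ∈ f.topInterval α, |s - z 0| < ε ∧ |f.map s - z 1| < ε := by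
  obtain ⟨_, ⟨s, hs, rfl⟩, hd⟩ := Metric.mem_closure_iff.1 hz ε hε
  rw [dist_comm, dist_eq_norm] at hd
  refine ⟨s, hs, lt_of_le_of_lt ?_ hd, lt_of_le_of_lt ?_ hd⟩
  · simpa using abs_apply_le_norm (!₂[s, f.map s] - z) 0
  · simpa using abs_apply_le_norm (!₂[s, f.map s] - z) 1

/-- The closed graph of a branch is strictly increasing, and so is its inverse. -/
theorem PreGIET.IsGIET.branchGraph_lt_iff (hf : f.IsGIET) {α : 𝒜} {z z' : Plane}
    (hz : z ∈ f.branchGraph α) (hz' : z' ∈ f.branchGraph α) : z 0 < z' 0 ↔ z 1 < z' 1 := by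
  have hmem : ∀ {ε : ℝ}, 0 < ε → ∃ s ∈ f.topInterval α, ∃ s' ∈ f.topInterval α,
      |s - z 0| < ε ∧ |f.map s - z 1| < ε ∧ |s' - z' 0| < ε ∧ |f.map s' - z' 1| < ε := by
    intro ε hε
    obtain ⟨s, hs, h1, h2⟩ := exists_near_of_mem_branchGraph hz hε
    obtain ⟨s', hs', h3, h4⟩ := exists_near_of_mem_branchGraph hz' hε
    exact ⟨s, hs, s', hs', h1, h2, h3, h4⟩
  have hlt := fun {s t : ℝ} (hs : s ∈ f.topInterval α) (ht : t ∈ f.topInterval α) =>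
    (hf.strictMonoOn α).lt_iff_lt hs ht
  -- the intervals are convex, so between the two points there is room for two separating points of
  -- the graph; monotonicity is then used between these and approximations of the given points
  have hconv : ∀ {s s' u : ℝ}, s ∈ f.topInterval α → s' ∈ f.topInterval α → s ≤ u → u ≤ s' →
      u ∈ f.topInterval α := fun hs hs' h1 h2 =>
    ⟨hs.1.trans h1, h2.trans_lt hs'.2.1, fun β hβ => h2.trans_lt (hs'.2.2 β hβ)⟩
  have hconv' : ∀ {s s' u : ℝ}, s ∈ f.botInterval α → s' ∈ f.botInterval α → s ≤ u → u ≤ s' →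
      u ∈ f.botInterval α := fun hs hs' h1 h2 =>
    ⟨hs.1.trans h1, h2.trans_lt hs'.2.1, fun β hβ => h2.trans_lt (hs'.2.2 β hβ)⟩
  constructor
  · intro h
    set η := (z' 0 - z 0) / 3 with hη
    have hηpos : 0 < η := by rw [hη]; linarith
    obtain ⟨s₁, hs₁, s₁', hs₁', h1, -, h3, -⟩ := hmem hηpos
    have h1 := abs_lt.1 h1
    have h3 := abs_lt.1 h3
    have hu : z 0 + η ∈ f.topInterval α := hconv hs₁ hs₁' (by linarith) (by linarith)
    have hv : z' 0 - η ∈ f.topInterval α := hconv hs₁ hs₁' (by linarith) (by linarith)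
    have huv : f.map (z 0 + η) < f.map (z' 0 - η) := (hlt hu hv).2 (by linarith)
    set δ := (f.map (z' 0 - η) - f.map (z 0 + η)) / 2 with hδ
    have hδpos : 0 < δ := by rw [hδ]; linarith
    obtain ⟨s, hs, s', hs', k1, k2, k3, k4⟩ := hmem (lt_min hηpos hδpos)
    have k1 := abs_lt.1 (k1.trans_le (min_le_left _ _))
    have k2 := abs_lt.1 (k2.trans_le (min_le_right _ _))
    have k3 := abs_lt.1 (k3.trans_le (min_le_left _ _))
    have k4 := abs_lt.1 (k4.trans_le (min_le_right _ _))
    have m1 := (hlt hs hu).2 (by linarith)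
    have m2 := (hlt hv hs').2 (by linarith)
    linarith
  · intro h
    set η := (z' 1 - z 1) / 3 with hη
    have hηpos : 0 < η := by rw [hη]; linarith
    obtain ⟨s₁, hs₁, s₁', hs₁', -, h2, -, h4⟩ := hmem hηpos
    have h2 := abs_lt.1 h2
    have h4 := abs_lt.1 h4
    obtain ⟨u, hu, hfu⟩ := hf.exists_preimage (t := z 1 + η)
      (hconv' (hf.map_mem hs₁) (hf.map_mem hs₁') (by linarith) (by linarith))
    obtain ⟨v, hv, hfv⟩ := hf.exists_preimage (t := z' 1 - η)
      (hconv' (hf.map_mem hs₁) (hf.map_mem hs₁') (by linarith) (by linarith))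
    have huv : u < v := (hlt hu hv).1 (by rw [hfu, hfv]; linarith)
    set δ := (v - u) / 2 with hδ
    have hδpos : 0 < δ := by rw [hδ]; linarith
    obtain ⟨s, hs, s', hs', k1, k2, k3, k4⟩ := hmem (lt_min hηpos hδpos)
    have k1 := abs_lt.1 (k1.trans_le (min_le_right _ _))
    have k2 := abs_lt.1 (k2.trans_le (min_le_left _ _))
    have k3 := abs_lt.1 (k3.trans_le (min_le_right _ _))
    have k4 := abs_lt.1 (k4.trans_le (min_le_left _ _))
    have m1 := (hlt hs hu).1 (by rw [hfu]; linarith)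
    have m2 := (hlt hv hs').1 (by rw [hfv]; linarith)
    linarith

/-- The closed graph of a branch contains the upper right corner. -/
theorem PreGIET.IsGIET.corner_mem_branchGraph (hf : f.IsGIET) {α : 𝒜} {a b c d : ℝ}
    (ht : f.topInterval α = Ico a b) (hb : f.botInterval α = Ico c d) :
    (!₂[b, d] : Plane) ∈ f.branchGraph α := by
  have hab : a < b := by
    have := ht ▸ hf.crit_mem α; exact this.1.trans_lt this.2
  have hcd : c < d := by
    have := hb ▸ hf.val_mem α; exact this.1.trans_lt this.2
  refine Metric.mem_closure_iff.2 fun ε hε => ?_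
  have hs₁ : max a (b - ε / 3) ∈ f.topInterval α := by
    rw [ht]; exact ⟨le_max_left _ _, max_lt hab (by linarith)⟩
  obtain ⟨s₂, hs₂, hfs₂⟩ := hf.exists_preimage (t := max c (d - ε / 3))
    (by rw [hb]; exact ⟨le_max_left _ _, max_lt hcd (by linarith)⟩)
  set s₁ := max a (b - ε / 3) with hs₁def
  obtain ⟨s, hs, h1, h2⟩ : ∃ s ∈ f.topInterval α, s₁ ≤ s ∧ f.map s₂ ≤ f.map s := by
    rcases le_total s₁ s₂ with h | h
    · exact ⟨s₂, hs₂, h, le_rfl⟩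
    · exact ⟨s₁, hs₁, le_rfl, (hf.strictMonoOn α).monotoneOn hs₂ hs₁ h⟩
  refine ⟨_, ⟨s, hs, rfl⟩, ?_⟩
  have h3 : s < b := by have := ht ▸ hs; exact this.2
  have h4 : f.map s < d := by have := hb ▸ hf.map_mem hs; exact this.2
  have h5 : b - ε / 3 ≤ s := (le_max_right _ _).trans h1
  have h6 : d - ε / 3 ≤ f.map s := (le_max_right _ _).trans (hfs₂ ▸ h2)
  rw [dist_eq_norm]
  refine (norm_plane_le _).trans_lt ?_
  have h7 : |b - s| ≤ ε / 3 := by rw [abs_le]; constructor <;> linarith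
  have h8 : |d - f.map s| ≤ ε / 3 := by rw [abs_le]; constructor <;> linarith
  simp only [PiLp.sub_apply, Matrix.cons_val_zero, Matrix.cons_val_one]
  linarith

/-- The properties of the pieces `D_α` of a possibly degenerate GIET that pulling back needs: `E` is
compact and is a strictly increasing relation. This includes single points. -/
structure IsMonotonePiece (E : Set Plane) : Prop where
  isClosed : IsClosed E
  nonempty : E.Nonempty
  isBounded : Bornology.IsBounded E
  lt_iff : ∀ z ∈ E, ∀ z' ∈ E, z 0 < z' 0 ↔ z 1 < z' 1

theorem IsMonotonePiece.eq_of_eq {E : Set Plane} (hE : IsMonotonePiece E) {p p' q : ℝ}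
    (h : (!₂[p, q] : Plane) ∈ E) (h' : (!₂[p', q] : Plane) ∈ E) : p = p' := by
  have h1 := hE.lt_iff _ h _ h'
  have h2 := hE.lt_iff _ h' _ h
  simp only [Matrix.cons_val_zero, Matrix.cons_val_one, lt_self_iff_false,
    iff_false, not_lt] at h1 h2
  exact le_antisymm h2 h1

theorem IsMonotonePiece.mk_lt_iff {E : Set Plane} (hE : IsMonotonePiece E) {p p' q q' : ℝ}
    (h : (!₂[p, q] : Plane) ∈ E) (h' : (!₂[p', q'] : Plane) ∈ E) : p < p' ↔ q < q' :=
  hE.lt_iff _ h _ h'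

theorem PreGIET.IsGIET.isMonotonePiece (hf : f.IsGIET) (α : 𝒜) :
    IsMonotonePiece (f.branchGraph α) where
  isClosed := isClosed_closure
  nonempty := ⟨_, PreGIET.mk_mem_branchGraph (hf.crit_mem α)⟩
  isBounded := by
    refine Bornology.IsBounded.closure ?_
    refine isBounded_iff_forall_norm_le.2
      ⟨|f.crit α| + |f.hi| + (|f.val α| + |f.hi|), ?_⟩
    rintro _ ⟨s, hs, rfl⟩
    have habs : ∀ {a b t : ℝ}, a ≤ t → t < b → |t| ≤ |a| + |b| := by
      intro a b t h1 h2
      rw [abs_le]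
      constructor
      · linarith [neg_abs_le a, abs_nonneg b]
      · linarith [le_abs_self b, abs_nonneg a]
    refine (norm_plane_le _).trans (add_le_add ?_ ?_)
    · simpa using habs hs.1 hs.2.1
    · have := hf.map_mem hs
      simpa using habs this.1 this.2.1
  lt_iff := fun _ hz _ hz' => hf.branchGraph_lt_iff hz hz'

theorem isMonotonePiece_singleton (z : Plane) : IsMonotonePiece {z} where
  isClosed := isClosed_singleton
  nonempty := singleton_nonempty z
  isBounded := Bornology.isBounded_singleton
  lt_iff := by rintro _ rfl _ rfl; simp

theorem isMonotonePiece_of_mem_extendedGIETSpace {π : CombDatum 𝒜} {a b : ℝ}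
    {D : 𝒜 → Set Plane} (hD : D ∈ ExtendedGIETSpace π a b) (α : 𝒜) : IsMonotonePiece (D α) := by
  rcases hD with ⟨f, hf, rfl⟩ | ⟨s, -, -, π', -, f, hf, hs, hns⟩
  · exact hf.1.isMonotonePiece α
  · by_cases hα : α ∈ s
    · rw [hs ⟨α, hα⟩]
      exact hf.1.isMonotonePiece _
    · obtain ⟨x, -, y, -, h⟩ := hns α hα
      rw [h]
      exact isMonotonePiece_singleton _

end Branches

/-! ### Pulling back a grid -/

section PullBack

variable {𝒜 : Type*} [Fintype 𝒜]

/-- Let the grid `x` contain the left endpoints of the bottom intervals of `f`, with `l α` grid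
intervals in the one of `α`. The preimages of the grid points form a grid `y` that contains the
left endpoints of the top intervals. -/
theorem PreGIET.IsGIET.exists_pullback [Nonempty 𝒜] {f : PreGIET 𝒜} (hf : f.IsGIET) {l : 𝒜 → ℕ}
    (hl : ∀ α, 0 < l α) {x : ℕ → ℝ} (hx : StrictMonoOn x (Iic (∑ χ, l χ)))
    (hhi : f.hi = x (∑ χ, l χ)) (hval : ∀ α, f.val α = x (blockStart f.datum.bot l α)) :
    ∃ y : ℕ → ℝ, y 0 = f.lo ∧ (∀ i, ∑ χ, l χ ≤ i → y i = f.hi) ∧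
      (∀ α, f.crit α = y (blockStart f.datum.top l α)) ∧
      (∀ α, f.topInterval α =
        Ico (y (blockStart f.datum.top l α)) (y (blockStart f.datum.top l α + l α))) ∧
      (∀ α k, k < l α → y (blockStart f.datum.top l α + k) ∈ f.topInterval α ∧
        f.map (y (blockStart f.datum.top l α + k)) = x (blockStart f.datum.bot l α + k)) ∧
      ∀ α k, k ≤ l α → (!₂[y (blockStart f.datum.top l α + k),
        x (blockStart f.datum.bot l α + k)] : Plane) ∈ f.branchGraph α := by
  have hbot : ∀ α, f.botInterval α =
      Ico (x (blockStart f.datum.bot l α)) (x (blockStart f.datum.bot l α + l α)) := fun α =>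
    interval_eq_grid_Ico f.datum.bot l hf.val_lt hf.val_lt_hi hval hhi α
  have hbotmem : ∀ α k, k < l α → x (blockStart f.datum.bot l α + k) ∈ f.botInterval α := by
    intro α k hk
    have h := blockStart_add_le_sum f.datum.bot l α
    rw [hbot]
    exact ⟨hx.monotoneOn (by simp only [mem_Iic]; omega) (by simp only [mem_Iic]; omega)
      (Nat.le_add_right _ _), hx (by simp only [mem_Iic]; omega) (by simp only [mem_Iic]; omega)
      (by omega)⟩
  have hpre : ∀ i, ∃ p, (∑ χ, l χ ≤ i → p = f.hi) ∧ ∀ α k, k < l α →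
      i = blockStart f.datum.top l α + k →
        p ∈ f.topInterval α ∧ f.map p = x (blockStart f.datum.bot l α + k) := by
    intro i
    by_cases hi : i < ∑ χ, l χ
    · obtain ⟨α, k, hk, rfl⟩ := exists_block f.datum.top l hi
      obtain ⟨p, hp, hfp⟩ := hf.exists_preimage (hbotmem α k hk)
      refine ⟨p, fun h => absurd hi (not_lt.2 h), fun β m hm h => ?_⟩
      obtain ⟨rfl, rfl⟩ := block_unique f.datum.top l hk hm h
      exact ⟨hp, hfp⟩
    · refine ⟨f.hi, fun _ => rfl, fun α k hk h => ?_⟩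
      have := blockStart_add_le_sum f.datum.top l α
      omega
  choose y hy using hpre
  have hyhi : ∀ i, ∑ χ, l χ ≤ i → y i = f.hi := fun i => (hy i).1
  have hymem : ∀ α k, k < l α → y (blockStart f.datum.top l α + k) ∈ f.topInterval α ∧
      f.map (y (blockStart f.datum.top l α + k)) = x (blockStart f.datum.bot l α + k) :=
    fun α k hk => (hy _).2 α k hk rfl
  have hcrit : ∀ α, f.crit α = y (blockStart f.datum.top l α) := by
    intro α
    obtain ⟨h1, h2⟩ := hymem α 0 (hl α)
    refine (hf.strictMonoOn α).injOn (hf.crit_mem α) h1 ?_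
    rw [hf.map_crit, hval]; exact h2.symm
  have htop : ∀ α, f.topInterval α =
      Ico (y (blockStart f.datum.top l α)) (y (blockStart f.datum.top l α + l α)) := fun α =>
    interval_eq_grid_Ico f.datum.top l hf.crit_lt hf.crit_lt_hi hcrit (hyhi _ le_rfl).symm α
  refine ⟨y, ?_, hyhi, hcrit, htop, hymem, fun α k hk => ?_⟩
  · have h0 : 0 < Fintype.card 𝒜 := Fintype.card_pos
    have h1 := hf.crit_first (f.datum.top.symm ⟨0, h0⟩) (by simp)
    rw [hcrit, blockStart] at h1
    simpa [cumLength_zero] using h1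
  · rcases hk.lt_or_eq with hk | rfl
    · rw [← (hymem α k hk).2]
      exact PreGIET.mk_mem_branchGraph (hymem α k hk).1
    · exact hf.corner_mem_branchGraph (htop α) (hbot α)

/-- If the grid is its own preimage, then `f` is modelled on it. -/
theorem PreGIET.IsGIET.isModelledOn [Nonempty 𝒜] {f : PreGIET 𝒜} (hf : f.IsGIET) {l : 𝒜 → ℕ}
    (hl : ∀ α, 0 < l α) {x : ℕ → ℝ} (hx : StrictMonoOn x (Iic (∑ χ, l χ)))
    (hlo : f.lo = x 0) (hhi : f.hi = x (∑ χ, l χ))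
    (hval : ∀ α, f.val α = x (blockStart f.datum.bot l α))
    (hinv : ∀ α k, k < l α → (!₂[x (blockStart f.datum.top l α + k),
        x (blockStart f.datum.bot l α + k)] : Plane) ∈ f.branchGraph α) :
    IsModelledOn f l x := by
  obtain ⟨y, -, hyhi, hcrit, -, hymem, hygraph⟩ := hf.exists_pullback hl hx hhi hval
  have hpos : ∀ α k, k < l α → y (blockStart f.datum.top l α + k) =
      x (blockStart f.datum.top l α + k) := fun α k hk =>
    (hf.isMonotonePiece α).eq_of_eq (hygraph α k hk.le) (hinv α k hk)
  have hyx : ∀ i ≤ ∑ χ, l χ, y i = x i := by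
    intro i hi
    rcases hi.lt_or_eq with hi | rfl
    · obtain ⟨α, k, hk, rfl⟩ := exists_block f.datum.top l hi
      exact hpos α k hk
    · rw [hyhi _ le_rfl, hhi]
  have hcrit' : ∀ α, f.crit α = x (blockStart f.datum.top l α) := fun α => by
    rw [hcrit α]; exact hpos α 0 (hl α)
  refine ⟨hx, hlo, hhi, hcrit', hval, ?_⟩
  rintro _ _ ⟨α, k, hk, rfl, rfl⟩
  have htop := interval_eq_grid_Ico f.datum.top l hf.crit_lt hf.crit_lt_hi hcrit' hhi α
  have hbot := interval_eq_grid_Ico f.datum.bot l hf.val_lt hf.val_lt_hi hval hhi α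
  have ht := blockStart_add_le_sum f.datum.top l α
  have hb := blockStart_add_le_sum f.datum.bot l α
  have hsub : ∀ p, p + l α ≤ ∑ χ, l χ → Ico (x (p + k)) (x (p + k + 1)) ⊆
      Ico (x p) (x (p + l α)) := by
    intro p hp
    refine Ico_subset_Ico (hx.monotoneOn ?_ ?_ ?_) (hx.monotoneOn ?_ ?_ ?_) <;>
      first | omega | (simp only [mem_Iic]; omega)
  have hsubt : Ico (x (blockStart f.datum.top l α + k)) (x (blockStart f.datum.top l α + k + 1)) ⊆
      f.topInterval α := (hsub _ ht).trans htop.ge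
  have hsubb : Ico (x (blockStart f.datum.bot l α + k)) (x (blockStart f.datum.bot l α + k + 1)) ⊆
      f.botInterval α := (hsub _ hb).trans hbot.ge
  have hg : ∀ m ≤ l α, (!₂[x (blockStart f.datum.top l α + m),
      x (blockStart f.datum.bot l α + m)] : Plane) ∈ f.branchGraph α := fun m hm => by
    rw [← hyx _ (by omega)]; exact hygraph α m hm
  have hiff : ∀ m ≤ l α, ∀ s ∈ f.topInterval α, s < x (blockStart f.datum.top l α + m) ↔
      f.map s < x (blockStart f.datum.bot l α + m) := fun m hm s hs =>
    (hf.isMonotonePiece α).mk_lt_iff (PreGIET.mk_mem_branchGraph hs) (hg m hm)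
  have hmem : ∀ s ∈ f.topInterval α,
      (s ∈ Ico (x (blockStart f.datum.top l α + k)) (x (blockStart f.datum.top l α + k + 1)) ↔
        f.map s ∈ Ico (x (blockStart f.datum.bot l α + k))
          (x (blockStart f.datum.bot l α + k + 1))) := by
    intro s hs
    rw [mem_Ico, mem_Ico, ← not_lt, ← not_lt, hiff k hk.le s hs]
    exact and_congr_right fun _ => hiff (k + 1) hk s hs
  refine ⟨?_, fun s hs => (hmem s (hsubt hs)).1 hs, (hf.strictMonoOn α).injOn.mono hsubt, ?_⟩
  · rw [← hpos α k hk]; exact (hymem α k hk).2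
  · intro t htmem
    obtain ⟨s, hs, rfl⟩ := hf.exists_preimage (hsubb htmem)
    exact ⟨s, (hmem s hs).2 htmem, rfl⟩

end PullBack

/-! ### Grids of the unit interval -/

section UnitGrid

variable {N : ℕ}

/-- The grid of the unit interval whose consecutive points have distances `g`. -/
def gridPoint (g : Fin N → ℝ) (i : ℕ) : ℝ :=
  cumLength (Equiv.refl (Fin N)) g i

theorem gridPoint_zero (g : Fin N → ℝ) : gridPoint g 0 = 0 := cumLength_zero _ _

theorem gridPoint_succ (g : Fin N → ℝ) {i : ℕ} (hi : i < N) :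
    gridPoint g (i + 1) = gridPoint g i + g ⟨i, hi⟩ := cumLength_succ _ _ hi

theorem gridPoint_last {g : Fin N → ℝ} (hg : g ∈ stdSimplex ℝ (Fin N)) : gridPoint g N = 1 :=
  (cumLength_card _ _).trans hg.2

theorem continuous_gridPoint (i : ℕ) : Continuous fun g : Fin N → ℝ => gridPoint g i := by
  unfold gridPoint cumLength
  exact continuous_finsetSum _ fun j _ => continuous_apply j

theorem gridPoint_mono {g : Fin N → ℝ} (hg : ∀ i, 0 ≤ g i) : Monotone (gridPoint g) := by
  intro i j hij
  unfold gridPoint cumLength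
  refine Finset.sum_le_sum_of_subset_of_nonneg (fun χ => ?_) fun χ _ _ => hg χ
  simp only [Finset.mem_filter, Finset.mem_univ, true_and]
  omega

theorem gridPoint_strictMonoOn {g : Fin N → ℝ} (hg : ∀ i, 0 < g i) :
    StrictMonoOn (gridPoint g) (Iic N) := by
  refine strictMonoOn_Iic_of_lt_succ fun i hi => ?_
  rw [Nat.succ_eq_succ, Nat.succ_eq_add_one, gridPoint_succ g hi]
  exact lt_add_of_pos_right _ (hg _)

/-- Grids are determined by the distances of consecutive points. -/
theorem eq_of_gridPoint_sub {g : Fin N → ℝ} {y : ℕ → ℝ} (hy : y 0 = 0)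
    (h : ∀ i : Fin N, y (i + 1) - y i = g i) : ∀ i ≤ N, y i = gridPoint g i := by
  intro i
  induction i with
  | zero => intro _; rw [hy, gridPoint_zero]
  | succ i ih =>
    intro hi
    have := h ⟨i, hi⟩
    rw [gridPoint_succ g hi, ← ih (by omega), ← this]
    ring

variable {𝒜 : Type*} [Fintype 𝒜]

/-- The lengths of the blocks of a grid, where the letters are in the order `e` and the block of
`α` has `l α` grid intervals. -/
def blockLengths {d : ℕ} (e : 𝒜 ≃ Fin d) (l : 𝒜 → ℕ) (g : Fin N → ℝ) (α : 𝒜) : ℝ :=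
  gridPoint g (blockStart e l α + l α) - gridPoint g (blockStart e l α)

theorem continuous_blockLengths {d : ℕ} (e : 𝒜 ≃ Fin d) (l : 𝒜 → ℕ) :
    Continuous fun g : Fin N → ℝ => blockLengths e l g :=
  continuous_pi fun _ => (continuous_gridPoint _).sub (continuous_gridPoint _)

theorem cumLength_blockLengths {d : ℕ} (e : 𝒜 ≃ Fin d) (l : 𝒜 → ℕ) (g : Fin N → ℝ) {j : ℕ}
    (hj : j ≤ d) : cumLength e (blockLengths e l g) j = gridPoint g (cumLength e l j) := by
  induction j with
  | zero => rw [cumLength_zero, cumLength_zero, gridPoint_zero]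
  | succ j ih =>
    rw [cumLength_succ e _ hj, ih (by omega), blockLengths, blockStart_add, blockStart]
    simp

theorem blockStart_blockLengths {d : ℕ} (e : 𝒜 ≃ Fin d) (l : 𝒜 → ℕ) (g : Fin N → ℝ) (α : 𝒜) :
    blockStart e (blockLengths e l g) α = gridPoint g (blockStart e l α) :=
  cumLength_blockLengths e l g (e α).isLt.le

theorem sum_blockLengths {d : ℕ} (e : 𝒜 ≃ Fin d) (l : 𝒜 → ℕ) {g : Fin N → ℝ}
    (hg : g ∈ stdSimplex ℝ (Fin N)) (hN : N = ∑ χ, l χ) : ∑ α, blockLengths e l g α = 1 := by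
  rw [← cumLength_card e, cumLength_blockLengths e l g le_rfl, cumLength_card, ← hN,
    gridPoint_last hg]

theorem blockLengths_mem_stdSimplex {d : ℕ} (e : 𝒜 ≃ Fin d) (l : 𝒜 → ℕ) {g : Fin N → ℝ}
    (hg : g ∈ stdSimplex ℝ (Fin N)) (hN : N = ∑ χ, l χ) :
    blockLengths e l g ∈ stdSimplex ℝ 𝒜 :=
  ⟨fun _ => sub_nonneg.2 (gridPoint_mono hg.1 (Nat.le_add_right _ _)), sum_blockLengths e l hg hN⟩

theorem blockLengths_mem_openSimplex {d : ℕ} (e : 𝒜 ≃ Fin d) {l : 𝒜 → ℕ} (hl : ∀ α, 0 < l α)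
    {g : Fin N → ℝ} (hg : g ∈ openSimplex (Fin N)) (hN : N = ∑ χ, l χ) :
    blockLengths e l g ∈ openSimplex 𝒜 := by
  refine ⟨fun α => sub_pos.2 ?_, sum_blockLengths e l ⟨fun i => (hg.1 i).le, hg.2⟩ hN⟩
  have := blockStart_add_le_sum e l α
  have := hl α
  exact gridPoint_strictMonoOn hg.1 (by simp only [mem_Iic]; omega) (by simp only [mem_Iic]; omega)
    (by omega)

theorem openSimplex_subset : openSimplex 𝒜 ⊆ stdSimplex ℝ 𝒜 := fun _ hτ =>
  ⟨fun α => (hτ.1 α).le, hτ.2⟩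

theorem stdSimplex_subset_closure_openSimplex [Nonempty 𝒜] :
    stdSimplex ℝ 𝒜 ⊆ closure (openSimplex 𝒜) := by
  intro τ hτ
  have hcard : (0 : ℝ) < Fintype.card 𝒜 := by exact_mod_cast Fintype.card_pos
  let c : ℝ → 𝒜 → ℝ := fun t α => (1 - t) * τ α + t * (Fintype.card 𝒜 : ℝ)⁻¹
  have hc : Continuous c := by fun_prop
  have h0 : c 0 = τ := by ext α; simp [c]
  have ht : Tendsto c (𝓝[>] 0) (𝓝 τ) := by
    have := hc.tendsto 0
    rw [h0] at this
    exact this.mono_left nhdsWithin_le_nhds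
  refine mem_closure_of_tendsto ht ?_
  filter_upwards [Ioo_mem_nhdsGT (zero_lt_one' ℝ)] with t ht
  refine ⟨fun α => ?_, ?_⟩
  · have h1 := mul_nonneg (sub_nonneg.2 ht.2.le) (hτ.1 α)
    have h2 := mul_pos ht.1 (inv_pos.2 hcard)
    simp only [c]
    linarith
  · simp only [c]
    rw [Finset.sum_add_distrib, ← Finset.mul_sum, hτ.2, Finset.sum_const, Finset.card_univ,
      nsmul_eq_mul]
    field_simp
    ring

end UnitGrid

/-! ### The pull-back map of a full family -/

section Family

variable {𝒜 : Type*} [Fintype 𝒜]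

theorem hausdorffDist_le_pieceDist (D D' : 𝒜 → Set Plane) (α : 𝒜) :
    Metric.hausdorffDist (D α) (D' α) ≤ pieceDist D D' :=
  Finset.single_le_sum (f := fun α => Metric.hausdorffDist (D α) (D' α))
    (fun _ _ => Metric.hausdorffDist_nonneg) (Finset.mem_univ α)

/-- The relation `z ∈ G τ α` is closed, if `G` is continuous on `S` for the distance of pieces. -/
theorem mem_piece_of_tendsto {G : (𝒜 → ℝ) → 𝒜 → Set Plane} {S : Set (𝒜 → ℝ)}
    (hG : ∀ τ ∈ S, ∀ α, IsMonotonePiece (G τ α))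
    (hcont : ∀ τ ∈ S, Tendsto (fun τ' => pieceDist (G τ') (G τ)) (𝓝[S] τ) (𝓝 0))
    {X : Type*} {F : Filter X} [F.NeBot] {t : X → 𝒜 → ℝ} {z : X → Plane} {τ : 𝒜 → ℝ} {z₀ : Plane}
    (hτ : τ ∈ S) (ht : Tendsto t F (𝓝 τ)) (htS : ∀ᶠ a in F, t a ∈ S)
    (hz : Tendsto z F (𝓝 z₀)) {α : 𝒜} (hmem : ∀ᶠ a in F, z a ∈ G (t a) α) : z₀ ∈ G τ α := by
  have hE := hG τ hτ α
  rw [hE.isClosed.mem_iff_infDist_zero hE.nonempty]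
  refine le_antisymm ?_ Metric.infDist_nonneg
  have hlim : Tendsto (fun a => pieceDist (G (t a)) (G τ) + dist z₀ (z a)) F (𝓝 (0 + 0)) := by
    refine ((hcont τ hτ).comp (tendsto_nhdsWithin_iff.2 ⟨ht, htS⟩)).add ?_
    rw [← dist_self z₀]
    exact tendsto_const_nhds.dist hz
  rw [add_zero] at hlim
  refine ge_of_tendsto hlim ?_
  filter_upwards [htS, hmem] with a ha hza
  have hE' := hG (t a) ha α
  refine Metric.infDist_le_infDist_add_dist.trans (add_le_add_left ?_ _)
  refine (Metric.infDist_le_hausdorffDist_of_mem hza ?_).trans (hausdorffDist_le_pieceDist _ _ α)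
  exact Metric.hausdorffEDist_ne_top_of_nonempty_of_bounded hE'.nonempty hE.nonempty
    hE'.isBounded hE.isBounded

/-- `y` is a preimage of the grid with distances `g` under the pieces `G τ`, where `τ` is the vector
of lengths of the bottom blocks of the grid. The condition for `k = l α` says that the end of the
block of `α` lies on the piece of `α`, and not only on that of the next letter; so the two endpoints
of every grid interval lie on a common piece. The values `y i` with `i > N` are fixed in order to
make `y` unique. -/
structure IsGridPreimage (π : CombDatum 𝒜) (l : 𝒜 → ℕ) (G : (𝒜 → ℝ) → 𝒜 → Set Plane) {N : ℕ}
    (g : Fin N → ℝ) (y : ℕ → ℝ) : Prop where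
  mem_Icc : ∀ i, y i ∈ Icc (0 : ℝ) 1
  zero : y 0 = 0
  one : ∀ i, N ≤ i → y i = 1
  mem : ∀ α k, k ≤ l α → (!₂[y (blockStart π.top l α + k),
    gridPoint g (blockStart π.bot l α + k)] : Plane) ∈ G (blockLengths π.bot l g) α

/-- A continuous family of possibly degenerate GIETs over the closed simplex. -/
structure IsPieceFamily (G : (𝒜 → ℝ) → 𝒜 → Set Plane) : Prop where
  isMonotonePiece : ∀ τ ∈ stdSimplex ℝ 𝒜, ∀ α, IsMonotonePiece (G τ α)
  tendsto : ∀ τ ∈ stdSimplex ℝ 𝒜,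
    Tendsto (fun τ' => pieceDist (G τ') (G τ)) (𝓝[stdSimplex ℝ 𝒜] τ) (𝓝 0)

variable {π : CombDatum 𝒜} {l : 𝒜 → ℕ} {G : (𝒜 → ℝ) → 𝒜 → Set Plane} {N : ℕ}

theorem isClosed_gridPreimage (hG : IsPieceFamily G) (hN : N = ∑ χ, l χ) :
    IsClosed {p : (Fin N → ℝ) × (ℕ → ℝ) |
      p.1 ∈ stdSimplex ℝ (Fin N) ∧ IsGridPreimage π l G p.1 p.2} := by
  rw [isClosed_iff_ultrafilter]
  rintro ⟨g, y⟩ U hU hmem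
  have h1 : Tendsto Prod.fst (U : Filter ((Fin N → ℝ) × (ℕ → ℝ))) (𝓝 g) :=
    (continuous_fst.tendsto (g, y)).mono_left hU
  have h2 : Tendsto Prod.snd (U : Filter ((Fin N → ℝ) × (ℕ → ℝ))) (𝓝 y) :=
    (continuous_snd.tendsto (g, y)).mono_left hU
  have h2' : ∀ i, Tendsto (fun p : (Fin N → ℝ) × (ℕ → ℝ) => p.2 i) U (𝓝 (y i)) :=
    fun i => tendsto_pi_nhds.1 h2 i
  have hev : ∀ᶠ p in (U : Filter ((Fin N → ℝ) × (ℕ → ℝ))),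
      p.1 ∈ stdSimplex ℝ (Fin N) ∧ IsGridPreimage π l G p.1 p.2 := hmem
  have hg : g ∈ stdSimplex ℝ (Fin N) :=
    (isClosed_stdSimplex ℝ (Fin N)).mem_of_tendsto h1 (hev.mono fun _ h => h.1)
  refine ⟨hg, fun i => ?_, ?_, fun i hi => ?_, fun α k hk => ?_⟩
  · exact isClosed_Icc.mem_of_tendsto (h2' i) (hev.mono fun _ h => h.2.mem_Icc i)
  · exact isClosed_singleton.mem_of_tendsto (h2' 0) (hev.mono fun _ h => h.2.zero)
  · exact isClosed_singleton.mem_of_tendsto (h2' i) (hev.mono fun _ h => h.2.one i hi)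
  · refine mem_piece_of_tendsto hG.isMonotonePiece hG.tendsto
      (blockLengths_mem_stdSimplex π.bot l hg hN)
      (((continuous_blockLengths π.bot l).tendsto g).comp h1)
      (hev.mono fun p h => blockLengths_mem_stdSimplex π.bot l h.1 hN) ?_
      (hev.mono fun p h => h.2.mem α k hk)
    have h3 := ((continuous_gridPoint (N := N) (blockStart π.bot l α + k)).tendsto g).comp h1
    refine ((PiLp.continuous_toLp 2 _).tendsto _).comp (tendsto_pi_nhds.2 fun i => ?_)
    fin_cases i
    · exact h2' _
    · exact h3

theorem IsGridPreimage.unique (hG : IsPieceFamily G) (hN : N = ∑ χ, l χ) {g : Fin N → ℝ}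
    (hg : g ∈ stdSimplex ℝ (Fin N)) {y y' : ℕ → ℝ} (hy : IsGridPreimage π l G g y)
    (hy' : IsGridPreimage π l G g y') : y = y' := by
  ext i
  by_cases hi : i < N
  · rw [hN] at hi
    obtain ⟨α, k, hk, rfl⟩ := exists_block π.top l hi
    exact (hG.isMonotonePiece _ (blockLengths_mem_stdSimplex π.bot l hg hN) α).eq_of_eq
      (hy.mem α k hk.le) (hy'.mem α k hk.le)
  · rw [hy.one i (not_lt.1 hi), hy'.one i (not_lt.1 hi)]

theorem IsGridPreimage.lt_iff (hG : IsPieceFamily G) (hN : N = ∑ χ, l χ) {g : Fin N → ℝ}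
    (hg : g ∈ stdSimplex ℝ (Fin N)) {y : ℕ → ℝ} (hy : IsGridPreimage π l G g y) {i j : ℕ}
    (hij : DiscreteIET π l i j) :
    y i < y (i + 1) ↔ gridPoint g j < gridPoint g (j + 1) := by
  obtain ⟨α, k, hk, rfl, rfl⟩ := hij
  exact (hG.isMonotonePiece _ (blockLengths_mem_stdSimplex π.bot l hg hN) α).mk_lt_iff
    (hy.mem α k hk.le) (hy.mem α (k + 1) hk)

theorem IsGridPreimage.le_succ (hG : IsPieceFamily G) (hN : N = ∑ χ, l χ) {g : Fin N → ℝ}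
    (hg : g ∈ stdSimplex ℝ (Fin N)) {y : ℕ → ℝ} (hy : IsGridPreimage π l G g y) {i : ℕ}
    (hi : i < N) : y i ≤ y (i + 1) := by
  rw [hN] at hi
  obtain ⟨α, k, hk, rfl⟩ := exists_block π.top l hi
  refine not_lt.1 fun h => ?_
  have := ((hG.isMonotonePiece _ (blockLengths_mem_stdSimplex π.bot l hg hN) α).mk_lt_iff
    (hy.mem α (k + 1) hk) (hy.mem α k hk.le)).1 h
  exact absurd this (not_lt.2 (gridPoint_mono hg.1 (by omega)))

/-- If the preimages of all grids of the open simplex exist, then also those of the degenerate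
grids do, and they define a continuous map of the simplex; so some grid is its own preimage. -/
theorem exists_invariant_grid (hG : IsPieceFamily G) (hN : N = ∑ χ, l χ) (hN2 : 2 ≤ N)
    (hex : ∀ g ∈ openSimplex (Fin N), ∃ y, IsGridPreimage π l G g y) :
    ∃ g ∈ stdSimplex ℝ (Fin N), ∃ y, IsGridPreimage π l G g y ∧
      ∀ i ≤ N, y i = gridPoint g i := by
  have : Nontrivial (Fin N) := Fin.nontrivial_iff_two_le.2 hN2
  set W := {p : (Fin N → ℝ) × (ℕ → ℝ) |
      p.1 ∈ stdSimplex ℝ (Fin N) ∧ IsGridPreimage π l G p.1 p.2} with hW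
  have hWclosed : IsClosed W := isClosed_gridPreimage hG hN
  have hKc : IsCompact (Set.univ.pi fun _ : ℕ => Icc (0 : ℝ) 1) :=
    isCompact_univ_pi fun _ => isCompact_Icc
  have hWc : IsCompact W := by
    refine ((isCompact_stdSimplex ℝ (Fin N)).prod hKc).of_isClosed_subset hWclosed ?_
    rintro ⟨g, y⟩ ⟨hg, hy⟩
    exact ⟨hg, fun i _ => hy.mem_Icc i⟩
  have hall : ∀ g ∈ stdSimplex ℝ (Fin N), ∃ y, IsGridPreimage π l G g y := by
    have h1 : openSimplex (Fin N) ⊆ Prod.fst '' W := by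
      intro g hg
      obtain ⟨y, hy⟩ := hex g hg
      exact ⟨(g, y), ⟨openSimplex_subset hg, hy⟩, rfl⟩
    intro g hg
    obtain ⟨⟨g', y⟩, hmem, rfl⟩ := closure_minimal h1 (hWc.image continuous_fst).isClosed
      (stdSimplex_subset_closure_openSimplex hg)
    exact ⟨y, hmem.2⟩
  have hall' : ∀ g, ∃ y, g ∈ stdSimplex ℝ (Fin N) → IsGridPreimage π l G g y := fun g => by
    by_cases hg : g ∈ stdSimplex ℝ (Fin N)
    · exact (hall g hg).imp fun y hy _ => hy
    · exact ⟨0, fun h => absurd h hg⟩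
  choose Y hY using hall'
  have hYcont : ContinuousOn Y (stdSimplex ℝ (Fin N)) := by
    intro g hg
    refine hKc.tendsto_nhds_of_unique_mapClusterPt ?_ fun y _ hy => ?_
    · filter_upwards [self_mem_nhdsWithin] with g' hg' i _ using (hY g' hg').mem_Icc i
    · obtain ⟨U, hU, hlim⟩ := mapClusterPt_iff_ultrafilter.1 hy
      have h1 : Tendsto (fun g' => (g', Y g')) (U : Filter (Fin N → ℝ)) (𝓝 (g, y)) :=
        (tendsto_id'.2 (hU.trans nhdsWithin_le_nhds)).prodMk_nhds hlim
      have h2 : ∀ᶠ g' in (U : Filter (Fin N → ℝ)), (g', Y g') ∈ W := by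
        filter_upwards [hU self_mem_nhdsWithin] with g' hg' using ⟨hg', hY g' hg'⟩
      exact (hWclosed.mem_of_tendsto h1 h2).2.unique hG hN hg (hY g hg)
  have hYi : ∀ i, ContinuousOn (fun g => Y g i) (stdSimplex ℝ (Fin N)) := fun i =>
    (continuous_apply i).comp_continuousOn hYcont
  obtain ⟨g, hg, hfix⟩ := exists_fixedPoint_stdSimplex
    (Φ := fun g (i : Fin N) => Y g (i + 1) - Y g i)
    (continuousOn_pi.2 fun i => (hYi _).sub (hYi _)) (by
      intro g hg
      refine ⟨fun i => sub_nonneg.2 ((hY g hg).le_succ hG hN hg i.isLt), ?_⟩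
      rw [Fin.sum_univ_eq_sum_range (fun i => Y g (i + 1) - Y g i), Finset.sum_range_sub,
        (hY g hg).one N le_rfl, (hY g hg).zero, sub_zero])
  exact ⟨g, hg, Y g, hY g hg, eq_of_gridPoint_sub (hY g hg).zero fun i => congrFun hfix i⟩

/-- For a minimal discrete interval exchange an invariant grid is non-degenerate: the set of
degenerate grid intervals is invariant. -/
theorem DiscreteMinimal.gap_pos (hmin : DiscreteMinimal π l) (hG : IsPieceFamily G)
    (hN : N = ∑ χ, l χ) {g : Fin N → ℝ} (hg : g ∈ stdSimplex ℝ (Fin N)) {y : ℕ → ℝ}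
    (hy : IsGridPreimage π l G g y) (hfix : ∀ i ≤ N, y i = gridPoint g i) : ∀ i, 0 < g i := by
  have hZ := hmin {i | gridPoint g i < gridPoint g (i + 1)} fun i j hij => by
    have hi : i < N := hN ▸ hij.source_lt
    rw [mem_ofPred_eq, mem_ofPred_eq, ← hy.lt_iff hG hN hg hij, hfix i hi.le, hfix (i + 1) hi]
  rw [← hN] at hZ
  rcases hZ with h | h
  · intro i
    have := h i i.isLt
    rw [mem_ofPred_eq, gridPoint_succ g i.isLt] at this
    simpa using this
  · exfalso
    have hzero : ∀ i ≤ N, gridPoint g i = 0 := by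
      intro i
      induction i with
      | zero => intro _; exact gridPoint_zero g
      | succ i ih =>
        intro hi
        have h1 := h i hi
        rw [mem_ofPred_eq, not_lt, ih (by omega)] at h1
        exact le_antisymm h1 (by rw [← gridPoint_zero g]; exact gridPoint_mono hg.1 (Nat.zero_le _))
    have := hzero N le_rfl
    rw [gridPoint_last hg] at this
    exact one_ne_zero this

end Family

end FullFamilies

end

open FullFamilies in
theorem theorem3p1 {𝒜 : Type*} [Fintype 𝒜] [Nontrivial 𝒜]
    (π πstar : CombDatum 𝒜) (hπ : π.Admissible)
    (R : Set (CombDatum 𝒜)) (hR : IsRauzyClass R) (hπR : π ∈ R)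
    (hstarR : πstar ∈ R) (hstar : πstar.Cyclic)
    (F : (𝒜 → ℝ) → PreGIET 𝒜) (hF : IsFullFamily π F)
    (r : ℕ) (γ : List (RauzyArrow 𝒜)) (hγ : IsRauzyPath π γ πstar) (hr : γ.length = r) :
    ∃ τ ∈ openSimplex 𝒜, (F τ).AdmitsSteps r ∧ (F τ).rauzyPath r = γ := by
  obtain ⟨l, hl, hmin, hmodel⟩ := exists_discrete_model hstar hR.1 hR.2.1.2 γ π hπR hγ
  obtain ⟨G, hGF, hGmem, hGcont⟩ := hF.extends_continuously
  have hG : IsPieceFamily G :=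
    ⟨fun τ hτ α => isMonotonePiece_of_mem_extendedGIETSpace (hGmem τ hτ) α, hGcont⟩
  obtain ⟨N, hN⟩ : ∃ N, N = ∑ χ, l χ := ⟨_, rfl⟩
  have hN2 : 2 ≤ N := by
    have h1 : 1 < Fintype.card 𝒜 := Fintype.one_lt_card
    have h2 : Fintype.card 𝒜 ≤ ∑ χ, l χ := by
      simpa using Finset.card_nsmul_le_sum Finset.univ l 1 fun α _ => hl α
    omega
  have hval : ∀ g ∈ openSimplex (Fin N), ∀ α, (F (blockLengths π.bot l g)).val α =
      gridPoint g (blockStart π.bot l α) := by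
    intro g hg α
    rw [hF.val_eq _ (blockLengths_mem_openSimplex π.bot hl hg hN), ← blockStart_blockLengths]
    rfl
  have hex : ∀ g ∈ openSimplex (Fin N), ∃ y, IsGridPreimage π l G g y := by
    intro g hg
    have hτ := blockLengths_mem_openSimplex π.bot hl hg hN
    obtain ⟨hf, hdatum, hlo, hhi⟩ := hF.mem _ hτ
    obtain ⟨y, hy0, hyhi, -, htop, hymem, hygraph⟩ := hf.exists_pullback (x := gridPoint g) hl
      (hN ▸ gridPoint_strictMonoOn hg.1)
      (by rw [hhi, ← hN, gridPoint_last (openSimplex_subset hg)])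
      (by rw [hdatum]; exact hval g hg)
    rw [hdatum] at hymem hygraph
    rw [hlo] at hy0
    rw [hhi, ← hN] at hyhi
    refine ⟨y, fun i => ?_, hy0, hyhi, fun α k hk => by rw [hGF _ hτ]; exact hygraph α k hk⟩
    by_cases hi : i < N
    · rw [hN] at hi
      obtain ⟨α, k, hk, rfl⟩ := exists_block π.top l hi
      have h := (hymem α k hk).1
      have h1 := hf.lo_le_crit α
      rw [hlo] at h1
      exact ⟨h1.trans h.1, (h.2.1.trans_eq hhi).le⟩
    · rw [hyhi i (not_lt.1 hi)]; exact ⟨zero_le_one, le_rfl⟩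
  obtain ⟨g, hg, y, hy, hfix⟩ := exists_invariant_grid hG hN hN2 hex
  have hgpos : g ∈ openSimplex (Fin N) := ⟨hmin.gap_pos hG hN hg hy hfix, hg.2⟩
  have hτ := blockLengths_mem_openSimplex π.bot hl hgpos hN
  obtain ⟨hf, hdatum, hlo, hhi⟩ := hF.mem _ hτ
  refine ⟨_, hτ, hr ▸ hmodel _ (gridPoint g) hdatum (hf.isModelledOn hl
    (hN ▸ gridPoint_strictMonoOn hgpos.1) (by rw [hlo, gridPoint_zero])
    (by rw [hhi, ← hN, gridPoint_last hg]) (by rw [hdatum]; exact hval g hgpos) ?_)⟩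
  intro α k hk
  rw [hdatum, ← hGF _ hτ, ← hfix _ (by have := blockStart_add_le_sum π.top l α; omega)]
  exact hy.mem α k hk.le
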